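/- **Theorem 3.1.** Let $l,T>0$, $v\in\mathbb R$, $\tilde\ell,m\in\mathbb N$ with $m\ge 1$, $H=L^2(0,l)$ and $U=\mathbb R^m$ (Euclidean norm). For $z\in\mathbb R$ let $\mathcal T(z)\in\mathcal L(H)$ be the periodic shift operator: with $\eta:=z \bmod l\in[0,l)$, $(\mathcal T(z)f)(x)=f(x-\eta)$ for $\eta\le x\le l$ and $(\mathcal T(z)f)(x)=f(x-\eta+l)$ for $0\le x<\eta$. Write $\mathcal T'(z)f:=\frac{\mathrm d}{\mathrm dz}(\mathcal T(z)f)$, the derivative being taken in $H$. Let $\phi_1,\dots,\phi_{\tilde\ell}\in C^1_{\mathrm{per}}([0,l])=\{\phi\in C^1([0,l]) : \phi(0)=\phi(l),\ \phi'(0)=\phi'(l)\}$ be orthonormal in $H$ and such that $\phi_1,\dots,\phi_{\tilde\ell},\phi_1',\dots,\phi_{\tilde\ell}'$ are linearly independent. Let $b_1,\dots,b_m\in H^1_{\mathrm{per}}(0,l)\setminus\{0\}$, where $H^1_{\mathrm{per}}(0,l)=\{f\in H^1(0,l): f(0)=f(l)\}$, and let $\mathcal B\in\mathcal L(U,H)$,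 $\mathcal Bu=\sum_{k=1}^m u_kb_k$. With $e_1,\dots,e_m$ the standard basis of $\mathbb R^m$ put $$N=-[\langle\phi_i,\phi_j'\rangle_H]_{i,j},\quad M_2=[\langle\phi_i',\phi_j'\rangle_H]_{i,j},\quad B_1(z)=[\langle\mathcal T(z)\phi_i,\mathcal Be_j\rangle_H]_{i,j},\quad B_2(z)=[\langle\mathcal T'(z)\phi_i,\mathcal Be_j\rangle_H]_{i,j}.$$ Let $\alpha_0\in\mathbb R^{\tilde\ell}\setminus\{0\}$ and $z_0\in\mathbb R$. For $u\in L^2(0,T;U)$ consider the initial value problem $\alpha(0)=\alpha_0$, $z(0)=z_0$, $$\begin{bmatrix} I_{\tilde\ell} & N\alpha(t)\\ \alpha(t)^\top N^\top & \alpha(t)^\top M_2\alpha(t)\end{bmatrix}\begin{bmatrix}\dot\alpha(t)\\ \dot z(t)\end{bmatrix}=v\begin{bmatrix}N&0\\ \alpha(t)^\top M_2&0\end{bmatrix}\begin{bmatrix}\alpha(t)\\ z(t)\end{bmatrix}+\begin{bmatrix}B_1(z(t))\\ \alpha(t)^\top B_2(z(t))\end{bmatrix}u(t).\qquad(\ast)$$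 A Carathéodory solution of this problem on $[0,T]$ is a pair of absolutely continuous functions $\alpha:[0,T]\to\mathbb R^{\tilde\ell}$, $z:[0,T]\to\mathbb R$ that satisfies the initial conditions and, for almost every $t\in(0,T)$, the system $(\ast)$. Then there is a constant $C>0$, depending only on $l,T,v,(\phi_i),(b_k),\alpha_0,z_0$, such that for every $u\in L^2(0,T;U)$ with $$\|u\|^2_{L^2(0,T;U)}<\frac{\|\alpha_0\|^2}{\|\mathcal B\|^2_{\mathcal L(U,H)}\,e\,T\,\tilde\ell}$$ the initial value problem has exactly one Carathéodory solution $(\alpha,z)$ on $[0,T]$. This solution lies in $H^1(0,T;\mathbb R^{\tilde\ell})\times H^1(0,T)$ and satisfies $$\max\big(\|\alpha\|_{H^1(0,T;\mathbb R^{\tilde\ell})},\|z\|_{H^1(0,T)}\big)\le C .$$ -/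

import Mathlib

open MeasureTheory Set
open scoped ENNReal ContDiff Matrix

namespace SPODG

noncomputable section

/-! ### Lebesgue and Sobolev spaces on an interval -/

/-- Lebesgue measure on the open interval `(a, b)`. -/
abbrev intervalMeasure (a b : ℝ) : Measure ℝ := volume.restrict (Ioo a b)

/-- The Bochner space `L²(a, b; E)`. -/
abbrev L2 (a b : ℝ) (E : Type*) [NormedAddCommGroup E] := Lp E 2 (intervalMeasure a b)

/-- The state space `H = L²(0, l)`. -/
abbrev H (l : ℝ) := L2 0 l ℝ

/-- The control space `U = ℝ^m` with the Euclidean norm. -/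
abbrev U (m : ℕ) := EuclideanSpace ℝ (Fin m)

section Sobolev

variable {E : Type*} [NormedAddCommGroup E] [NormedSpace ℝ E]

/-- `g` is a weak derivative of `f` on `(a, b)`: `∫ ψ' f = - ∫ ψ g` for all `ψ ∈ C_c^∞(a, b)`. -/
def IsWeakDeriv (a b : ℝ) (f g : ℝ → E) : Prop :=
  ∀ ψ : ℝ → ℝ, ContDiff ℝ ∞ ψ → HasCompactSupport ψ → tsupport ψ ⊆ Ioo a b →
    ∫ x in Ioo a b, deriv ψ x • f x = - ∫ x in Ioo a b, ψ x • g x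

/-- `f ∈ H¹(a, b; E)`: both `f` and some weak derivative of it are square integrable. -/
def MemH1 (a b : ℝ) (f : ℝ → E) : Prop :=
  MemLp f 2 (intervalMeasure a b) ∧
    ∃ g : ℝ → E, MemLp g 2 (intervalMeasure a b) ∧ IsWeakDeriv a b f g

open Classical in
/-- The square integrable weak derivative of an `H¹` function (it is unique up to null sets). -/
def weakDeriv (a b : ℝ) (f : ℝ → E) : ℝ → E :=
  if h : MemH1 a b f then h.2.choose else 0

/-- The norm of `H¹(a, b; E)`: `(‖f‖²_{L²} + ‖f'‖²_{L²})^{1/2}`. -/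
def h1Norm (a b : ℝ) (f : ℝ → E) : ℝ :=
  Real.sqrt ((∫ x in Ioo a b, ‖f x‖ ^ 2) + ∫ x in Ioo a b, ‖weakDeriv a b f x‖ ^ 2)

end Sobolev

/-- `f ∈ H¹_per(0, l)`: `f ∈ H¹(0, l)`, and its continuous representative satisfies
`f(0) = f(l)`. -/
def MemH1per (l : ℝ) (f : H l) : Prop :=
  MemH1 0 l (f : ℝ → ℝ) ∧
    ∃ f₀ : ℝ → ℝ, ContinuousOn f₀ (Icc 0 l) ∧ (f : ℝ → ℝ) =ᵐ[intervalMeasure 0 l] f₀ ∧ f₀ 0 = f₀ l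

/-- The derivative of a function on `[0, l]`, one-sided at the end points. -/
def dx (l : ℝ) (φ : ℝ → ℝ) : ℝ → ℝ := derivWithin φ (Icc 0 l)

/-- `φ ∈ C¹_per([0, l])`; only the values of `φ` on `[0, l]` matter. -/
def MemC1per (l : ℝ) (φ : ℝ → ℝ) : Prop :=
  ContDiffOn ℝ 1 φ (Icc 0 l) ∧ φ 0 = φ l ∧ dx l φ 0 = dx l φ l

open Classical in
/-- The class in `L²(0, l)` of a square integrable function. -/
def toH (l : ℝ) (f : ℝ → ℝ) : H l :=
  if h : MemLp f 2 (intervalMeasure 0 l) then h.toLp f else 0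

/-! ### The periodic shift operator -/

/-- `z mod l`, as an element of `[0, l)`. -/
def modL (l z : ℝ) : ℝ := l * Int.fract (z / l)

/-- The point at which `𝒯(z)φ(x)` evaluates `φ`: with `η = z mod l` it is `x - η` for `η ≤ x` and
`x - η + l` for `x < η`. -/
def shiftPoint (l z x : ℝ) : ℝ :=
  if modL l z ≤ x then x - modL l z else x - modL l z + l

theorem measurable_shiftPoint (l z : ℝ) : Measurable (shiftPoint l z) :=
  Measurable.ite measurableSet_Ici (by fun_prop) (by fun_prop)

theorem measurePreserving_shiftPoint (l z : ℝ) :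
    MeasurePreserving (shiftPoint l z) (intervalMeasure 0 l) (intervalMeasure 0 l) := by
  refine ⟨measurable_shiftPoint l z, ?_⟩
  rcases le_or_gt l 0 with hl | hl
  · simp [intervalMeasure, Ioo_eq_empty (not_lt.mpr hl)]
  have h0 : 0 ≤ modL l z := mul_nonneg hl.le (Int.fract_nonneg _)
  have h1 : modL l z < l := by
    simpa [modL] using mul_lt_mul_of_pos_left (Int.fract_lt_one (z / l)) hl
  set η := modL l z with hη
  have hI : intervalMeasure 0 l = volume.restrict (Ico 0 l) :=
    Measure.restrict_congr_set Ioo_ae_eq_Ico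
  rw [hI]
  ext s hs
  rw [Measure.map_apply (measurable_shiftPoint l z) hs,
    Measure.restrict_apply (measurable_shiftPoint l z hs), Measure.restrict_apply hs]
  have e1 : shiftPoint l z ⁻¹' s ∩ Ico 0 l =
      (fun x => x + (-η)) ⁻¹' (s ∩ Ico 0 (l - η)) ∪
        (fun x => x + (l - η)) ⁻¹' (s ∩ Ico (l - η) l) := by
    ext x
    simp only [mem_inter_iff, mem_preimage, mem_union, mem_Ico, shiftPoint, ← hη]
    have r1 : x + -η = x - η := by ring
    have r2 : x + (l - η) = x - η + l := by ring
    rw [r1, r2]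
    split_ifs with hx
    · constructor
      · rintro ⟨a, b, c⟩
        exact Or.inl ⟨a, by linarith, by linarith⟩
      · rintro (⟨a, b, c⟩ | ⟨a, b, c⟩)
        · exact ⟨a, by linarith, by linarith⟩
        · exact absurd hx (by linarith)
    · constructor
      · rintro ⟨a, b, c⟩
        exact Or.inr ⟨a, by linarith, by linarith⟩
      · rintro (⟨a, b, c⟩ | ⟨a, b, c⟩)
        · exact absurd hx (by linarith)
        · exact ⟨a, by linarith, by linarith⟩
  have e2 : s ∩ Ico 0 l = (s ∩ Ico 0 (l - η)) ∪ (s ∩ Ico (l - η) l) := by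
    rw [← inter_union_distrib_left, Ico_union_Ico_eq_Ico (by linarith) (by linarith)]
  have d2 : Disjoint (s ∩ Ico 0 (l - η)) (s ∩ Ico (l - η) l) :=
    (Ico_disjoint_Ico_same).mono inter_subset_right inter_subset_right
  have d1 : Disjoint ((fun x => x + (-η)) ⁻¹' (s ∩ Ico 0 (l - η)))
      ((fun x => x + (l - η)) ⁻¹' (s ∩ Ico (l - η) l)) := by
    rw [Set.disjoint_left]
    rintro x ⟨-, hx⟩ ⟨-, hy⟩
    simp only [mem_Ico] at hx hy
    linarith
  have m1 : MeasurableSet (s ∩ Ico (l - η) l) := hs.inter measurableSet_Ico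
  rw [e1, e2, measure_union d1 (m1.preimage (measurable_add_const _)), measure_union d2 m1,
    measure_preimage_add_right, measure_preimage_add_right]

/-- The periodic shift operator `𝒯(z) ∈ 𝓛(L²(0, l))`. -/
def shift (l z : ℝ) : H l →L[ℝ] H l :=
  (Lp.compMeasurePreservingₗᵢ ℝ (shiftPoint l z)
    (measurePreserving_shiftPoint l z)).toContinuousLinearMap

/-- `𝒯'(z)φ = d/dz (𝒯(z)φ)`, the derivative being taken in `L²(0, l)`. -/
def shiftDeriv (l z : ℝ) (φ : H l) : H l := deriv (fun ζ : ℝ => shift l ζ φ) z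

/-! ### The reduced-order model -/

/-- The control operator `ℬ u = ∑ₖ uₖ bₖ`. -/
def controlOp {l : ℝ} {m : ℕ} (b : Fin m → H l) : U m →L[ℝ] H l :=
  ∑ k, (EuclideanSpace.proj k : U m →L[ℝ] ℝ).smulRight (b k)

section ROM

variable {n m : ℕ} (l : ℝ) (φ : Fin n → ℝ → ℝ) (b : Fin m → H l)

/-- `N = -[⟨φᵢ, φⱼ'⟩]`. -/
def matN : Matrix (Fin n) (Fin n) ℝ :=
  Matrix.of fun i j => - inner ℝ (toH l (φ i)) (toH l (dx l (φ j)))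

/-- `M₂ = [⟨φᵢ', φⱼ'⟩]`. -/
def matM2 : Matrix (Fin n) (Fin n) ℝ :=
  Matrix.of fun i j => inner ℝ (toH l (dx l (φ i))) (toH l (dx l (φ j)))

/-- `B₁(z) = [⟨𝒯(z)φᵢ, ℬeⱼ⟩]`. -/
def matB1 (z : ℝ) : Matrix (Fin n) (Fin m) ℝ :=
  Matrix.of fun i j =>
    inner ℝ (shift l z (toH l (φ i))) (controlOp b (EuclideanSpace.single j 1))

/-- `B₂(z) = [⟨𝒯'(z)φᵢ, ℬeⱼ⟩]`. -/
def matB2 (z : ℝ) : Matrix (Fin n) (Fin m) ℝ :=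
  Matrix.of fun i j =>
    inner ℝ (shiftDeriv l z (toH l (φ i))) (controlOp b (EuclideanSpace.single j 1))

/-- The two block rows of the sPOD-Galerkin system
`[I, Nα; αᵀNᵀ, αᵀM₂α] [α̇; ż] = v [N, 0; αᵀM₂, 0] [α; z] + [B₁(z); αᵀB₂(z)] u`
for given values of `α`, `z`, `α̇ = dα`, `ż = dz` and `u`. -/
def ROMEquation (v : ℝ) (α : Fin n → ℝ) (z : ℝ) (dα : Fin n → ℝ) (dz : ℝ) (u : Fin m → ℝ) :
    Prop :=
  dα + dz • (matN l φ *ᵥ α) = v • (matN l φ *ᵥ α) + matB1 l φ b z *ᵥ u ∧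
  α ⬝ᵥ ((matN l φ)ᵀ *ᵥ dα) + (α ⬝ᵥ (matM2 l φ *ᵥ α)) * dz =
    v * (α ⬝ᵥ (matM2 l φ *ᵥ α)) + α ⬝ᵥ (matB2 l φ b z *ᵥ u)

/-- `(α, z)` is a solution on `[0, T]`, in the sense of Carathéodory, of the sPOD-Galerkin system
with `α(0) = α₀`, `z(0) = z₀`: both functions are absolutely continuous on `[0, T]` (hence
differentiable almost everywhere), and the system holds at almost every time. -/
def IsCaratheodorySolution (T v : ℝ) (α₀ : EuclideanSpace ℝ (Fin n)) (z₀ : ℝ) (u : L2 0 T (U m))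
    (α : ℝ → EuclideanSpace ℝ (Fin n)) (z : ℝ → ℝ) : Prop :=
  AbsolutelyContinuousOnInterval α 0 T ∧ AbsolutelyContinuousOnInterval z 0 T ∧
  α 0 = α₀ ∧ z 0 = z₀ ∧
  ∀ᵐ t ∂(intervalMeasure 0 T),
    ROMEquation l φ b v (α t).ofLp (z t) (deriv α t).ofLp (deriv z t) ((u : ℝ → U m) t).ofLp

end ROM

end

end SPODG

namespace SPODG

/-! ### Absolutely continuous functions and primitives of vector-valued integrable functions -/

section AbsolutelyContinuous

variable {X Y E : Type*} [PseudoMetricSpace X] [PseudoMetricSpace Y]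
  [NormedAddCommGroup E] [NormedSpace ℝ E]

open Filter Topology AbsolutelyContinuousOnInterval

/-! Put s = ż - v. The first block row reads α̇ = B₁(z)u - s Nα, and inserting it into the second
row leaves the scalar equation s‖Aα‖² = ⟨α, B₂(z)u⟩ - ⟨Nα, B₁(z)u⟩. Here Aα is the component of ∑
αᵢφᵢ' orthogonal to span(φᵢ), and ‖Aα‖² is the Schur complement of the mass matrix
(`romEquation_iff`, `norm_opA_sq`). Linear independence of the φᵢ and φᵢ' makes A injective, so ‖α‖
≤ κ‖Aα‖ in finite dimension: the system degenerates only at α = 0.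

Two structural facts control it. Periodicity makes N skew-symmetric, so ⟨α, α̇⟩ = ⟨α, B₁(z)u⟩ and
‖α‖ changes at rate at most ‖ℬ‖‖u‖. By Cauchy–Schwarz the total change is at most ‖ℬ‖√T‖u‖, which
the hypothesis on u bounds by (2/3)‖α₀‖ because e·n ≥ 9/4; thus ‖α‖ ≥ ‖α₀‖/3 along every solution.
Secondly, 𝒯'(z)φᵢ = -𝒯(z)φᵢ', and integration by parts moves the derivative onto the periodic H¹
functions bₖ, so that B₂, like B₁, is bounded and Lipschitz in z (`MemH1per.exists_inner_shift_dx`,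
`bddLip_shiftTest`).

Replacing ‖Aα‖ in the denominators by max(‖Aα‖, δ) with δ = ‖α₀‖/(3κ) gives a bounded, globally
Lipschitz control field (`bddLip_truncField`), and Picard iteration solves the truncated problem
uniquely on all of [0,T]. The lower bound on ‖α‖ holds for solutions of the truncated and of the
original problem alike, so the truncation is never active and the two problems have the same
solutions (`exists_reduced_solution`). The bound M of the field does not depend on u; it yields |v|
+ M‖u(t)‖ as a bound for the derivatives, hence the uniform H¹ estimate. -/

theorem absolutelyContinuousOnInterval_of_dist_le {f : ℝ → X} {g : ℝ → Y} {a b : ℝ}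
    (hg : AbsolutelyContinuousOnInterval g a b)
    (h : ∀ s ∈ uIcc a b, ∀ t ∈ uIcc a b, dist (f s) (f t) ≤ dist (g s) (g t)) :
    AbsolutelyContinuousOnInterval f a b := by
  refine squeeze_zero' (Eventually.of_forall fun _ => Finset.sum_nonneg fun _ _ => dist_nonneg)
    ?_ hg
  filter_upwards [mem_inf_of_right (mem_principal_self _)] with I hI
  exact Finset.sum_le_sum fun i hi => h _ (hI.1 i hi).1 _ (hI.1 i hi).2

theorem absolutelyContinuousOnInterval_prodMk {f : ℝ → X} {g : ℝ → Y} {a b : ℝ}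
    (hf : AbsolutelyContinuousOnInterval f a b) (hg : AbsolutelyContinuousOnInterval g a b) :
    AbsolutelyContinuousOnInterval (fun t => (f t, g t)) a b := by
  have h := Tendsto.add hf hg
  rw [add_zero] at h
  refine squeeze_zero (fun _ => Finset.sum_nonneg fun _ _ => dist_nonneg) (fun I => ?_) h
  rw [← Finset.sum_add_distrib]
  refine Finset.sum_le_sum fun i _ => ?_
  rw [Prod.dist_eq]
  exact max_le_add_of_nonneg dist_nonneg dist_nonneg

/-- Increments of the primitive are dominated by those of the primitive of ‖f‖, which reduces the
claim to the scalar case. -/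
theorem absolutelyContinuousOnInterval_primitive {f : ℝ → E} {a b : ℝ}
    (hf : IntervalIntegrable f volume a b) :
    AbsolutelyContinuousOnInterval (fun t => ∫ s in a..t, f s) a b := by
  refine absolutelyContinuousOnInterval_of_dist_le
    (hf.norm.absolutelyContinuousOnInterval_intervalIntegral (c := a) left_mem_uIcc) ?_
  intro s hs t ht
  have hi : ∀ r ∈ uIcc a b, IntervalIntegrable f volume a r := fun r hr =>
    hf.mono_set (uIcc_subset_uIcc left_mem_uIcc hr)
  rw [dist_comm, dist_eq_norm, dist_comm (∫ _ in a..s, _), Real.dist_eq,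
    intervalIntegral.integral_interval_sub_left (hi t ht) (hi s hs),
    intervalIntegral.integral_interval_sub_left (hi t ht).norm (hi s hs).norm]
  exact intervalIntegral.norm_integral_le_abs_integral_norm

theorem ae_hasDerivAt_primitive [CompleteSpace E] {f : ℝ → E} {a b : ℝ} (hab : a ≤ b)
    (hf : IntervalIntegrable f volume a b) :
    ∀ᵐ t ∂(intervalMeasure a b), HasDerivAt (fun t => ∫ s in a..t, f s) (f t) t := by
  rw [ae_restrict_iff' measurableSet_Ioo]
  filter_upwards [hf.ae_hasDerivAt_integral] with t ht htI
  refine ht ?_ a left_mem_uIcc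
  rw [uIcc_of_le hab]
  exact Ioo_subset_Icc_self htI

theorem ae_mem_uIcc_of_ae_intervalMeasure {a b : ℝ} (hab : a ≤ b) {p : ℝ → Prop}
    (h : ∀ᵐ t ∂(intervalMeasure a b), p t) : ∀ᵐ t, t ∈ uIcc a b → p t := by
  rw [intervalMeasure, Measure.restrict_congr_set Ioo_ae_eq_Icc,
    ae_restrict_iff' measurableSet_Icc] at h
  rwa [uIcc_of_le hab]

/-- The fundamental theorem of calculus for absolutely continuous functions with values in a Banach
space, given an integrable almost everywhere derivative. -/
theorem eq_add_integral_of_absolutelyContinuous [CompleteSpace E] {f f' : ℝ → E} {a b : ℝ}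
    (hab : a ≤ b) (hf : AbsolutelyContinuousOnInterval f a b)
    (hf' : IntervalIntegrable f' volume a b)
    (h : ∀ᵐ t ∂(intervalMeasure a b), HasDerivAt f (f' t) t) :
    ∀ t ∈ Icc a b, f t = f a + ∫ s in a..t, f' s := by
  have hd := (ae_mem_uIcc_of_ae_intervalMeasure hab
    (h.and (ae_hasDerivAt_primitive hab hf'))).mono fun t ht htI => by
      simpa using (ht htI).1.sub (ht htI).2
  obtain ⟨C, hC⟩ := (hf.sub
    (absolutelyContinuousOnInterval_primitive hf')).const_of_ae_hasDerivAt_zero hd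
  rw [uIcc_of_le hab] at hC
  intro t ht
  have h1 := hC t ht
  have h2 := hC a ⟨le_rfl, hab⟩
  simp only [Pi.sub_apply, intervalIntegral.integral_same, sub_zero] at h1 h2
  rw [h2, ← h1]
  simp

theorem intervalIntegrable_of_memLp {F : Type*} [NormedAddCommGroup F] {f : ℝ → F} {a b : ℝ} (hab : a ≤ b)
    (hf : MemLp f 2 (intervalMeasure a b)) : IntervalIntegrable f volume a b := by
  rw [intervalIntegrable_iff_integrableOn_Ioo_of_le hab]
  exact hf.integrable one_le_two

theorem intervalIntegral_eq_integral_Ioo {f : ℝ → E} {a b : ℝ} (hab : a ≤ b) :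
    ∫ t in a..b, f t = ∫ t in Ioo a b, f t := by
  rw [intervalIntegral.integral_of_le hab, integral_Ioc_eq_integral_Ioo]

/-- The integrand is, up to the factor n + 1, the a.e. derivative of a power of an absolutely
continuous primitive. This produces the factorials in Picard iteration when the Lipschitz weight k
is merely integrable. -/
theorem integral_pow_mul_primitive {k : ℝ → ℝ} {a b : ℝ} (hab : a ≤ b)
    (hk : IntervalIntegrable k volume a b) (n : ℕ) :
    ∫ t in a..b, k t * (∫ s in a..t, k s) ^ n = (∫ s in a..b, k s) ^ (n + 1) / (n + 1) := by
  have hK := absolutelyContinuousOnInterval_primitive hk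
  have hpow : ∀ n : ℕ,
      AbsolutelyContinuousOnInterval (fun t => (∫ s in a..t, k s) ^ (n + 1)) a b := by
    intro n
    induction n with
    | zero => simpa using hK
    | succ n ih => simpa [pow_succ] using ih.fun_mul hK
  have h1 := eq_add_integral_of_absolutelyContinuous
    (f' := fun t => (n + 1) * (k t * (∫ s in a..t, k s) ^ n)) hab (hpow n) ?_ ?_ b ⟨hab, le_rfl⟩
  · rw [intervalIntegral.integral_const_mul] at h1
    simp only [intervalIntegral.integral_same, ne_eq, Nat.succ_ne_zero, not_false_eq_true,
      zero_pow, zero_add] at h1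
    rw [h1]
    have : (n : ℝ) + 1 ≠ 0 := by positivity
    field_simp
  · exact (hk.mul_continuousOn (hK.continuousOn.pow n)).const_mul _
  · filter_upwards [ae_hasDerivAt_primitive hab hk] with t ht
    refine (ht.pow (n + 1)).congr_deriv ?_
    push_cast
    ring

end AbsolutelyContinuous

/-! ### Picard iteration with an integrable control -/

section Picard

variable {E V : Type*} [NormedAddCommGroup E] [NormedSpace ℝ E]
  [NormedAddCommGroup V] [NormedSpace ℝ V]

open scoped NNReal

theorem intervalIntegrable_affine_control {G : E → V →L[ℝ] E} (hG : Continuous G) (c : E)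
    {u : ℝ → V} {T : ℝ} (hT : 0 ≤ T) (hu : IntervalIntegrable u volume 0 T)
    {x : ℝ → E} (hx : ContinuousOn x (Icc 0 T)) :
    IntervalIntegrable (fun s => c + G (x s) (u s)) volume 0 T := by
  refine intervalIntegrable_const.add ?_
  rw [intervalIntegrable_iff_integrableOn_Icc_of_le hT] at hu ⊢
  have hGx : ContinuousOn (fun s => G (x s)) (Icc 0 T) := hG.comp_continuousOn hx
  obtain ⟨M, hM⟩ := isCompact_Icc.exists_bound_of_continuousOn hGx
  refine Integrable.mono' (hu.norm.const_mul M) ?_ ?_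
  · have h1 : AEStronglyMeasurable (fun s => G (x s)) (volume.restrict (Icc 0 T)) :=
      hGx.aestronglyMeasurable_of_isCompact isCompact_Icc measurableSet_Icc
    exact (isBoundedBilinearMap_apply (𝕜 := ℝ) (E := V)
      (F := E)).continuous.comp_aestronglyMeasurable (h1.prodMk hu.aestronglyMeasurable)
  · filter_upwards [ae_restrict_mem measurableSet_Icc] with s hs
    exact ((G (x s)).le_opNorm _).trans (by gcongr; exact hM s hs)

/-- Picard's theorem for the integral equation `x(t) = x₀ + ∫₀ᵗ (c + G(x) u)` with a globally
Lipschitz `G` and an integrable control `u`. -/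
theorem exists_unique_integral_solution [CompleteSpace E] {G : E → V →L[ℝ] E} {L : ℝ≥0} (hG : LipschitzWith L G)
    (c x₀ : E) {u : ℝ → V} {T : ℝ} (hT : 0 ≤ T) (hu : IntervalIntegrable u volume 0 T) :
    ∃ x : ℝ → E, ContinuousOn x (Icc 0 T) ∧
      (∀ t ∈ Icc 0 T, x t = x₀ + ∫ s in 0..t, (c + G (x s) (u s))) ∧
      ∀ y : ℝ → E, ContinuousOn y (Icc 0 T) →
        (∀ t ∈ Icc 0 T, y t = x₀ + ∫ s in 0..t, (c + G (y s) (u s))) → EqOn y x (Icc 0 T) := by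
  have hsub : ∀ t ∈ Icc 0 T, uIcc 0 t ⊆ uIcc 0 T := fun t ht =>
    uIcc_subset_uIcc left_mem_uIcc (by rwa [uIcc_of_le hT])
  have hext : ∀ x : C(Icc 0 T, E), Continuous (IccExtend hT x) := fun x => x.continuous.Icc_extend'
  have hint : ∀ x : C(Icc 0 T, E),
      IntervalIntegrable (fun s => c + G (IccExtend hT x s) (u s)) volume 0 T := fun x =>
    intervalIntegrable_affine_control hG.continuous c hT hu (hext x).continuousOn
  let Γ : C(Icc 0 T, E) → C(Icc 0 T, E) := fun x =>
    ⟨fun t => x₀ + ∫ s in 0..(t : ℝ), (c + G (IccExtend hT x s) (u s)), by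
      refine continuous_const.add ?_
      have := intervalIntegral.continuousOn_primitive_interval' (hint x) left_mem_uIcc
      rw [uIcc_of_le hT] at this
      exact continuousOn_iff_continuous_domRestrict.mp this⟩
  have hΓ : ∀ x t, Γ x t = x₀ + ∫ s in 0..(t : ℝ), (c + G (IccExtend hT x s) (u s)) :=
    fun _ _ => rfl
  let k : ℝ → ℝ := fun s => L * ‖u s‖
  have hk : IntervalIntegrable k volume 0 T := hu.norm.const_mul _
  have hk0 : ∀ s, 0 ≤ k s := fun s => by positivity
  -- With K(t) = ∫₀ᵗ L‖u‖, the n-th iterate has Lipschitz constant K(T)ⁿ/n!, so some iterate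
  -- contracts on the whole interval and no continuation in time is needed.
  have key : ∀ (n : ℕ) (x y : C(Icc 0 T, E)) (t : Icc (0 : ℝ) T),
      dist ((Γ^[n] x) t) ((Γ^[n] y) t) ≤
        (∫ s in 0..(t : ℝ), k s) ^ n / n.factorial * dist x y := by
    intro n
    induction n with
    | zero => intro x y t; simpa using ContinuousMap.dist_apply_le_dist t
    | succ n ih =>
      intro x y t
      have ht := t.2
      rw [Function.iterate_succ_apply', Function.iterate_succ_apply', hΓ, hΓ, dist_add_left,
        dist_eq_norm, ← intervalIntegral.integral_sub ((hint _).mono_set (hsub t ht))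
          ((hint _).mono_set (hsub t ht))]
      have hkt : IntervalIntegrable k volume 0 t := hk.mono_set (hsub t ht)
      have hKc : ContinuousOn (fun r => ∫ s in 0..r, k s) (uIcc 0 (t : ℝ)) :=
        intervalIntegral.continuousOn_primitive_interval' hkt left_mem_uIcc
      calc _ ≤ ∫ s in 0..(t : ℝ), (dist x y / n.factorial) * (k s * (∫ r in 0..s, k r) ^ n) := by
            refine intervalIntegral.norm_integral_le_of_norm_le ht.1 (ae_of_all _ fun s hs => ?_)
              ((hkt.mul_continuousOn (hKc.pow n)).const_mul _)
            have hs' : s ∈ Icc 0 T := ⟨hs.1.le, hs.2.trans ht.2⟩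
            rw [add_sub_add_left_eq_sub, ← sub_apply,
              IccExtend_of_mem _ _ hs', IccExtend_of_mem _ _ hs']
            calc _ ≤ ‖G ((Γ^[n] x) ⟨s, hs'⟩) - G ((Γ^[n] y) ⟨s, hs'⟩)‖ * ‖u s‖ :=
                  ContinuousLinearMap.le_opNorm _ _
              _ ≤ (L * ((∫ s in 0..s, k s) ^ n / n.factorial * dist x y)) * ‖u s‖ := by
                  gcongr
                  rw [← dist_eq_norm]
                  exact (hG.dist_le_mul _ _).trans (by gcongr; exact ih x y ⟨s, hs'⟩)
              _ = _ := by simp only [k]; ring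
        _ = _ := by
            rw [intervalIntegral.integral_const_mul, integral_pow_mul_primitive ht.1 hkt,
              Nat.factorial_succ]
            have : (n : ℝ) + 1 ≠ 0 := by positivity
            push_cast
            field_simp
  have hKT : ∀ t ∈ Icc 0 T, ∫ s in 0..t, k s ≤ ∫ s in 0..T, k s := fun t ht =>
    intervalIntegral.integral_mono_interval le_rfl ht.1 ht.2 (ae_of_all _ hk0) hk
  have hKn : ∀ t ∈ Icc 0 T, 0 ≤ ∫ s in 0..t, k s := fun t ht =>
    intervalIntegral.integral_nonneg ht.1 fun s _ => hk0 s
  obtain ⟨n, hn⟩ := ((FloorSemiring.tendsto_pow_div_factorial_atTop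
    (∫ s in 0..T, k s)).eventually (gt_mem_nhds one_half_pos)).exists
  have hcon : ContractingWith (1 / 2) (Γ^[n]) := by
    refine ⟨by rw [div_lt_one] <;> norm_num, LipschitzWith.of_dist_le_mul fun x y => ?_⟩
    rw [ContinuousMap.dist_le (by positivity)]
    intro t
    refine (key n x y t).trans ?_
    have h1 : (∫ s in 0..(t : ℝ), k s) ^ n / n.factorial ≤ 1 / 2 := by
      refine le_trans ?_ hn.le
      gcongr
      · exact hKn t t.2
      · exact hKT t t.2
    have h2 : ((1 / 2 : ℝ≥0) : ℝ) = 1 / 2 := by norm_num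
    rw [h2]
    gcongr
  have hne : Nonempty C(Icc 0 T, E) := ⟨0⟩
  set X := hcon.fixedPoint (Γ^[n]) with hX
  -- The unique fixed point of an iterate is fixed by the map itself.
  have hfix : Γ X = X := hcon.isFixedPt_fixedPoint_iterate
  refine ⟨IccExtend hT X, (hext X).continuousOn, fun t ht => ?_, fun y hy hys => ?_⟩
  · conv_lhs => rw [IccExtend_of_mem _ _ ht, ← hfix]
    rfl
  · let Y : C(Icc 0 T, E) := ⟨_, continuousOn_iff_continuous_domRestrict.mp hy⟩
    have hYe : ∀ s ∈ Icc 0 T, IccExtend hT Y s = y s := fun s hs => by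
      rw [IccExtend_of_mem _ _ hs]; rfl
    have hY : Γ Y = Y := by
      ext t
      rw [hΓ]
      change _ = y t
      rw [hys t t.2]
      congr 1
      refine intervalIntegral.integral_congr fun s hs => ?_
      have hs' : s ∈ Icc 0 T := by
        have := hsub t t.2 hs
        rwa [uIcc_of_le hT] at this
      simp only [hYe s hs']
    have hYX : Y = X := hcon.fixedPoint_unique (Function.IsFixedPt.iterate hY n)
    intro t ht
    rw [← hYX, hYe t ht]

end Picard

end SPODG

namespace SPODG

/-! ### Weak derivatives and H¹ on an interval -/

section WeakDerivative

variable {E : Type*} [NormedAddCommGroup E] [NormedSpace ℝ E] {a b : ℝ}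

theorem notMem_tsupport_left {ψ : ℝ → ℝ} (h : tsupport ψ ⊆ Ioo a b) : ψ a = 0 :=
  image_eq_zero_of_notMem_tsupport fun ha => lt_irrefl _ (h ha).1

theorem notMem_tsupport_right {ψ : ℝ → ℝ} (h : tsupport ψ ⊆ Ioo a b) : ψ b = 0 :=
  image_eq_zero_of_notMem_tsupport fun hb => lt_irrefl _ (h hb).2

theorem integrable_smul_of_continuous {ψ : ℝ → ℝ} (hψ : Continuous ψ) {f : ℝ → E}
    (hf : Integrable f (intervalMeasure a b)) :
    Integrable (fun x => ψ x • f x) (intervalMeasure a b) := by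
  obtain ⟨M, hM⟩ := (isCompact_Icc (a := a) (b := b)).exists_bound_of_continuousOn hψ.continuousOn
  refine hf.bdd_smul M hψ.aestronglyMeasurable ?_
  filter_upwards [ae_restrict_mem measurableSet_Ioo] with x hx
  exact hM x (Ioo_subset_Icc_self hx)

/-- The product ψf is absolutely continuous and vanishes at both end points, so its derivative
integrates to zero. -/
theorem isWeakDeriv_of_absolutelyContinuous [CompleteSpace E] {f g : ℝ → E} (hab : a ≤ b)
    (hf : AbsolutelyContinuousOnInterval f a b) (hg : IntervalIntegrable g volume a b)
    (h : ∀ᵐ t ∂(intervalMeasure a b), HasDerivAt f (g t) t) : IsWeakDeriv a b f g := by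
  intro ψ hψ _ hsupp
  have hψac : AbsolutelyContinuousOnInterval ψ a b :=
    (hψ.of_le (by simp)).contDiffOn.absolutelyContinuousOnInterval
  have hψ' : Continuous (deriv ψ) := hψ.continuous_deriv (by simp)
  have hfi : IntervalIntegrable f volume a b := hf.continuousOn.intervalIntegrable
  have h1 : IntervalIntegrable (fun t => deriv ψ t • f t) volume a b :=
    hfi.continuousOn_smul hψ'.continuousOn
  have h2 : IntervalIntegrable (fun t => ψ t • g t) volume a b :=
    hg.continuousOn_smul hψ.continuous.continuousOn
  have key := eq_add_integral_of_absolutelyContinuous (f := fun t => ψ t • f t)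
    (f' := fun t => deriv ψ t • f t + ψ t • g t) hab (hψac.fun_smul hf) (h1.add h2) (by
      filter_upwards [h] with t ht
      rw [add_comm]
      exact ((hψ.differentiable (by simp)) t).hasDerivAt.smul ht) b ⟨hab, le_rfl⟩
  simp only [notMem_tsupport_left hsupp, notMem_tsupport_right hsupp, zero_smul, zero_add] at key
  rw [intervalIntegral.integral_add h1 h2, intervalIntegral_eq_integral_Ioo hab,
    intervalIntegral_eq_integral_Ioo hab] at key
  exact eq_neg_of_add_eq_zero_left key.symm

theorem setIntegral_smul_of_tsupport_subset {θ : ℝ → ℝ} (hθ : tsupport θ ⊆ Ioo a b) (f : ℝ → E) :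
    ∫ x in Ioo a b, θ x • f x = ∫ x, θ x • f x := by
  refine setIntegral_eq_integral_of_forall_compl_eq_zero fun x hx => ?_
  rw [image_eq_zero_of_notMem_tsupport fun h => hx (hθ h), zero_smul]

theorem ae_eq_zero_of_forall_test [CompleteSpace E] {f : ℝ → E}
    (hf : Integrable f (intervalMeasure a b))
    (h : ∀ θ : ℝ → ℝ, ContDiff ℝ ∞ θ → HasCompactSupport θ → tsupport θ ⊆ Ioo a b →
      ∫ x in Ioo a b, θ x • f x = 0) : f =ᵐ[intervalMeasure a b] 0 := by
  rw [Filter.EventuallyEq, ae_restrict_iff' measurableSet_Ioo]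
  refine isOpen_Ioo.ae_eq_zero_of_integral_contDiff_smul_eq_zero
    (IntegrableOn.locallyIntegrableOn hf) fun θ h1 h2 h3 => ?_
  rw [← setIntegral_smul_of_tsupport_subset h3]
  exact h θ h1 h2 h3

theorem IsWeakDeriv.ae_eq [CompleteSpace E] {f g g' : ℝ → E} (hg : IsWeakDeriv a b f g)
    (hg' : IsWeakDeriv a b f g') (hi : Integrable g (intervalMeasure a b))
    (hi' : Integrable g' (intervalMeasure a b)) : g =ᵐ[intervalMeasure a b] g' := by
  have h : (fun x => g x - g' x) =ᵐ[intervalMeasure a b] 0 := by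
    refine ae_eq_zero_of_forall_test (hi.sub hi') fun θ h1 h2 h3 => ?_
    simp only [smul_sub]
    rw [integral_sub (integrable_smul_of_continuous h1.continuous hi)
      (integrable_smul_of_continuous h1.continuous hi'), sub_eq_zero, ← neg_inj,
      ← hg θ h1 h2 h3, ← hg' θ h1 h2 h3]
  filter_upwards [h] with x hx
  exact sub_eq_zero.mp hx

/-- A smooth function with compact support in `(a, b)` and vanishing integral has a primitive of
the same kind. -/
theorem exists_test_primitive {η : ℝ → ℝ} (hη : ContDiff ℝ ∞ η) (hc : HasCompactSupport η)
    (hs : tsupport η ⊆ Ioo a b) (h0 : ∫ x, η x = 0) :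
    ∃ ψ : ℝ → ℝ, ContDiff ℝ ∞ ψ ∧ HasCompactSupport ψ ∧ tsupport ψ ⊆ Ioo a b ∧ deriv ψ = η := by
  rcases (tsupport η).eq_empty_or_nonempty with he | hne
  · have hz : η = 0 := by rwa [tsupport_eq_empty_iff] at he
    refine ⟨0, contDiff_const, HasCompactSupport.zero, by simp [tsupport], ?_⟩
    rw [hz]
    ext x
    simp
  -- The primitive starts at the least point a' of the support; beyond the greatest point b' it
  -- vanishes because η has mean zero.
  obtain ⟨a', ha', hle⟩ := hc.isCompact.exists_isLeast hne
  obtain ⟨b', hb', hge⟩ := hc.isCompact.exists_isGreatest hne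
  have hzero : ∀ x, x ∉ Icc a' b' → η x = 0 := fun x hx =>
    image_eq_zero_of_notMem_tsupport fun h => hx ⟨hle h, hge h⟩
  have hder : ∀ x, HasDerivAt (fun x => ∫ t in a'..x, η t) (η x) x := fun x =>
    (hη.continuous.integral_hasStrictDerivAt a' x).hasDerivAt
  have hde : deriv (fun x => ∫ t in a'..x, η t) = η := funext fun x => (hder x).deriv
  have hsupp : Function.support (fun x => ∫ t in a'..x, η t) ⊆ Icc a' b' := by
    intro x hx
    by_contra hxI
    refine hx ?_
    rcases lt_or_ge x a' with hlt | hge'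
    · refine intervalIntegral.integral_zero_ae ?_
      have : ∀ᵐ t : ℝ, t ≠ a' := by simp [ae_iff, measure_singleton]
      filter_upwards [this] with t hne ht
      rw [uIoc_of_ge hlt.le] at ht
      exact hzero t fun h => hne (le_antisymm ht.2 h.1)
    · have hbx : b' < x := not_le.mp fun h => hxI ⟨hge', h⟩
      change ∫ t in a'..x, η t = 0
      rw [intervalIntegral.integral_of_le hge', ← integral_Icc_eq_integral_Ioc,
        setIntegral_eq_integral_of_forall_compl_eq_zero, h0]
      exact fun t ht => hzero t fun h => ht ⟨h.1, h.2.trans hbx.le⟩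
  have hts : tsupport (fun x => ∫ t in a'..x, η t) ⊆ Icc a' b' :=
    closure_minimal hsupp isClosed_Icc
  refine ⟨_, ?_, HasCompactSupport.intro isCompact_Icc fun x hx =>
    by_contra fun h => hx (hsupp h), hts.trans (Icc_subset_Ioo (hs ha').1 (hs hb').2), hde⟩
  rw [contDiff_infty_iff_deriv, hde]
  exact ⟨fun x => (hder x).differentiableAt, hη⟩

/-- The lemma of du Bois-Reymond: a function with vanishing weak derivative is constant. -/
theorem IsWeakDeriv.ae_eq_const [CompleteSpace E] {f : ℝ → E} (hab : a < b)
    (hf : Integrable f (intervalMeasure a b)) (h : IsWeakDeriv a b f 0) :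
    ∃ c : E, f =ᵐ[intervalMeasure a b] fun _ => c := by
  -- Fix a test function χ of integral one. For any test function θ, the difference θ - (∫θ)χ has
  -- mean zero, hence is the derivative of a test function; testing f with it gives ∫θf = (∫θ)∫χf,
  -- which identifies the constant as ∫χf.
  let B : ContDiffBump ((a + b) / 2) :=
    ⟨(b - a) / 8, (b - a) / 4, by linarith, by linarith⟩
  set χ := B.normed volume with hχ
  have hχs : tsupport χ ⊆ Ioo a b := by
    rw [hχ, B.tsupport_normed_eq, Real.closedBall_eq_Icc]
    change Icc ((a + b) / 2 - (b - a) / 4) ((a + b) / 2 + (b - a) / 4) ⊆ _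
    exact Icc_subset_Ioo (by linarith) (by linarith)
  have hχd : ContDiff ℝ ∞ χ := B.contDiff_normed
  have hχc : HasCompactSupport χ := B.hasCompactSupport_normed
  refine ⟨∫ x in Ioo a b, χ x • f x, ?_⟩
  set c := ∫ x in Ioo a b, χ x • f x with hcdef
  have h0 : (fun x => f x - c) =ᵐ[intervalMeasure a b] 0 := by
    refine ae_eq_zero_of_forall_test (hf.sub (integrable_const c)) fun θ h1 h2 h3 => ?_
    set J := ∫ x, θ x with hJ
    have hJχ : HasCompactSupport (fun x => J * χ x) := hχc.mul_left
    have hηs : tsupport (fun x => θ x - J * χ x) ⊆ Ioo a b := by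
      refine (tsupport_sub θ (fun x => J * χ x)).trans (union_subset h3 ?_)
      exact (tsupport_mul_subset_right (f := fun _ => J)).trans hχs
    obtain ⟨ψ, hψ1, hψ2, hψ3, hψ4⟩ := exists_test_primitive
      (h1.sub (contDiff_const.mul hχd)) (h2.sub hJχ) hηs (by
        rw [integral_sub (h1.continuous.integrable_of_hasCompactSupport h2)
          ((contDiff_const.mul hχd).continuous.integrable_of_hasCompactSupport hJχ),
          integral_const_mul, B.integral_normed, mul_one, sub_self])
    have hz := h ψ hψ1 hψ2 hψ3
    rw [hψ4] at hz
    have hi1 := integrable_smul_of_continuous h1.continuous hf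
    have hi2 := integrable_smul_of_continuous hχd.continuous hf
    simp only [sub_smul, mul_smul, Pi.zero_apply, smul_zero, integral_zero, neg_zero] at hz
    have hi3 : Integrable (fun x => J • χ x • f x) (intervalMeasure a b) := hi2.smul J
    rw [integral_sub hi1 hi3, integral_smul, sub_eq_zero] at hz
    simp only [smul_sub]
    rw [integral_sub hi1 (integrable_smul_of_continuous h1.continuous (integrable_const c)), hz,
      setIntegral_smul_of_tsupport_subset h3, integral_smul_const, sub_self]
  filter_upwards [h0] with x hx
  exact sub_eq_zero.mp hx

theorem IsWeakDeriv.ae_eq_primitive [CompleteSpace E] {f g : ℝ → E} (hab : a < b)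
    (h : IsWeakDeriv a b f g) (hf : Integrable f (intervalMeasure a b))
    (hg : Integrable g (intervalMeasure a b)) :
    ∃ c : E, f =ᵐ[intervalMeasure a b] fun x => c + ∫ t in a..x, g t := by
  have hgi : IntervalIntegrable g volume a b :=
    (intervalIntegrable_iff_integrableOn_Ioo_of_le hab.le).mpr hg
  have hPac := absolutelyContinuousOnInterval_primitive hgi
  have hP := isWeakDeriv_of_absolutelyContinuous hab.le hPac hgi (ae_hasDerivAt_primitive hab.le hgi)
  have hPi : Integrable (fun x => ∫ t in a..x, g t) (intervalMeasure a b) :=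
    (intervalIntegrable_iff_integrableOn_Ioo_of_le hab.le).mp
      hPac.continuousOn.intervalIntegrable
  obtain ⟨c, hc⟩ := IsWeakDeriv.ae_eq_const (f := fun x => f x - ∫ t in a..x, g t) hab
    (hf.sub hPi) (by
      intro ψ h1 h2 h3
      have hd : Continuous (deriv ψ) := h1.continuous_deriv (by simp)
      simp only [smul_sub]
      rw [integral_sub (integrable_smul_of_continuous hd hf) (integrable_smul_of_continuous hd hPi),
        h ψ h1 h2 h3, hP ψ h1 h2 h3]
      simp)
  refine ⟨c, ?_⟩
  filter_upwards [hc] with x hx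
  exact eq_add_of_sub_eq hx

theorem memH1_of_absolutelyContinuous [CompleteSpace E] {f g : ℝ → E} (hab : a ≤ b)
    (hf : AbsolutelyContinuousOnInterval f a b) (hg : MemLp g 2 (intervalMeasure a b))
    (h : ∀ᵐ t ∂(intervalMeasure a b), HasDerivAt f (g t) t) : MemH1 a b f := by
  refine ⟨?_, g, hg, isWeakDeriv_of_absolutelyContinuous hab hf
    (intervalIntegrable_of_memLp hab hg) h⟩
  have hc := hf.continuousOn
  rw [uIcc_of_le hab] at hc
  obtain ⟨M, hM⟩ := isCompact_Icc.exists_bound_of_continuousOn hc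
  refine MemLp.of_bound ((hc.aestronglyMeasurable_of_isCompact isCompact_Icc
    measurableSet_Icc).mono_measure (Measure.restrict_mono Ioo_subset_Icc_self le_rfl)) M ?_
  filter_upwards [ae_restrict_mem measurableSet_Ioo] with x hx
  exact hM x (Ioo_subset_Icc_self hx)

/-- The chosen weak derivative in `h1Norm` agrees a.e. with the pointwise one, by uniqueness of weak
derivatives. -/
theorem h1Norm_le_of_absolutelyContinuous [CompleteSpace E] {f g : ℝ → E} (hab : a ≤ b)
    (hf : AbsolutelyContinuousOnInterval f a b) (hg : MemLp g 2 (intervalMeasure a b))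
    (h : ∀ᵐ t ∂(intervalMeasure a b), HasDerivAt f (g t) t) {A : ℝ}
    (hA : ∀ t ∈ Icc a b, ‖f t‖ ≤ A) :
    h1Norm a b f ≤ Real.sqrt (A ^ 2 * (b - a) + ∫ t in Ioo a b, ‖g t‖ ^ 2) := by
  have hm := memH1_of_absolutelyContinuous hab hf hg h
  have hw : weakDeriv a b f = hm.2.choose := by simp [weakDeriv, hm]
  have hae : weakDeriv a b f =ᵐ[intervalMeasure a b] g := by
    rw [hw]
    exact IsWeakDeriv.ae_eq hm.2.choose_spec.2
      (isWeakDeriv_of_absolutelyContinuous hab hf (intervalIntegrable_of_memLp hab hg) h)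
      (hm.2.choose_spec.1.integrable one_le_two) (hg.integrable one_le_two)
  have h2 : ∫ t in Ioo a b, ‖weakDeriv a b f t‖ ^ 2 = ∫ t in Ioo a b, ‖g t‖ ^ 2 :=
    integral_congr_ae (hae.mono fun t ht => by simp only [ht])
  rw [h1Norm, h2]
  refine Real.sqrt_le_sqrt (add_le_add ?_ le_rfl)
  have h3 : ∫ t in Ioo a b, ‖f t‖ ^ 2 ≤ ∫ _ in Ioo a b, A ^ 2 := by
    refine setIntegral_mono_on hm.1.integrable_norm_pow' (integrable_const _) measurableSet_Ioo
      fun t ht => ?_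
    gcongr
    exact hA t (Ioo_subset_Icc_self ht)
  refine h3.trans_eq ?_
  simp [mul_comm, hab]

end WeakDerivative

end SPODG

namespace SPODG

/-! ### The periodic shift and its derivative -/

section Shift

variable {l : ℝ}

theorem modL_add_int_mul (hl : 0 < l) {y : ℝ} (hy : y ∈ Ico 0 l) (k : ℤ) :
    modL l (y + k * l) = y := by
  have h : (y + k * l) / l = y / l + k := by field_simp
  rw [modL, h, Int.fract_add_intCast, Int.fract_eq_self.mpr ⟨by have := hy.1; positivity,
    (div_lt_one hl).mpr hy.2⟩]
  field_simp

theorem modL_eq_self (hl : 0 < l) {y : ℝ} (hy : y ∈ Ico 0 l) : modL l y = y := by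
  simpa using modL_add_int_mul hl hy 0

theorem modL_mem (hl : 0 < l) (z : ℝ) : modL l z ∈ Ico 0 l :=
  ⟨mul_nonneg hl.le (Int.fract_nonneg _), by
    simpa [modL] using mul_lt_mul_of_pos_left (Int.fract_lt_one (z / l)) hl⟩

theorem modL_eq_sub (hl : 0 < l) (z : ℝ) : modL l z = z - ⌊z / l⌋ * l := by
  rw [modL, Int.fract]
  field_simp

theorem modL_add_period (hl : 0 < l) (z : ℝ) : modL l (z + l) = modL l z := by
  have h : (z + l) / l = z / l + 1 := by field_simp
  rw [modL, modL, h, Int.fract_add_one]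

/-- This turns 𝒯(z) into translation of the periodic extension, removing the case distinction. -/
theorem shiftPoint_eq_modL (hl : 0 < l) (z : ℝ) {x : ℝ} (hx : x ∈ Ioo 0 l) :
    shiftPoint l z x = modL l (x - z) := by
  have hη := modL_mem hl z
  have hz := modL_eq_sub hl z
  rw [shiftPoint]
  split_ifs with h
  · rw [← modL_add_int_mul hl (y := x - modL l z) ⟨by linarith, by linarith [hx.2, hη.1]⟩
      (-⌊z / l⌋)]
    congr 1
    rw [hz]
    push_cast
    ring
  · rw [← modL_add_int_mul hl (y := x - modL l z + l)
      ⟨by linarith [hx.1, hη.2], by linarith [not_le.mp h]⟩ (-⌊z / l⌋ - 1)]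
    congr 1
    rw [hz]
    push_cast
    ring

theorem continuous_comp_modL (hl : 0 < l) {f : ℝ → ℝ} (hf : ContinuousOn f (Icc 0 l))
    (h0 : f 0 = f l) : Continuous fun x => f (modL l x) := by
  have h1 : ContinuousOn (fun s => f (l * s)) (Icc 0 1) := by
    refine hf.comp (by fun_prop) fun s hs => ⟨mul_nonneg hl.le hs.1, ?_⟩
    simpa using mul_le_mul_of_nonneg_left hs.2 hl.le
  have h2 := h1.comp_fract'' (by simpa using h0)
  exact h2.comp (continuous_id.div_const l)

theorem memLp_of_continuousOn_Icc {f : ℝ → ℝ} (hf : ContinuousOn f (Icc 0 l)) :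
    MemLp f 2 (intervalMeasure 0 l) := by
  obtain ⟨M, hM⟩ := isCompact_Icc.exists_bound_of_continuousOn hf
  refine MemLp.of_bound ((hf.aestronglyMeasurable_of_isCompact isCompact_Icc
    measurableSet_Icc).mono_measure (Measure.restrict_mono Ioo_subset_Icc_self le_rfl)) M ?_
  filter_upwards [ae_restrict_mem measurableSet_Ioo] with x hx
  exact hM x (Ioo_subset_Icc_self hx)

theorem coeFn_toH {f : ℝ → ℝ} (hf : MemLp f 2 (intervalMeasure 0 l)) :
    (toH l f : ℝ → ℝ) =ᵐ[intervalMeasure 0 l] f := by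
  rw [toH, dif_pos hf]
  exact hf.coeFn_toLp

theorem coeFn_shift_toH (hl : 0 < l) {f : ℝ → ℝ} (hf : ContinuousOn f (Icc 0 l)) (z : ℝ) :
    (shift l z (toH l f) : ℝ → ℝ) =ᵐ[intervalMeasure 0 l] fun x => f (modL l (x - z)) := by
  have hp := measurePreserving_shiftPoint l z
  have h1 : (shift l z (toH l f) : ℝ → ℝ) =ᵐ[intervalMeasure 0 l]
      (toH l f : ℝ → ℝ) ∘ shiftPoint l z := Lp.coeFn_compMeasurePreserving _ hp
  have h2 := hp.quasiMeasurePreserving.ae_eq_comp (coeFn_toH (memLp_of_continuousOn_Icc hf))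
  filter_upwards [h1, h2, ae_restrict_mem measurableSet_Ioo] with x hx1 hx2 hx
  rw [hx1, hx2, Function.comp_apply, shiftPoint_eq_modL hl z hx]

theorem norm_shift (z : ℝ) (f : H l) : ‖shift l z f‖ = ‖f‖ :=
  LinearIsometry.norm_map _ _

theorem inner_shift_shift (z : ℝ) (f g : H l) :
    inner ℝ (shift l z f) (shift l z g) = inner ℝ f g :=
  LinearIsometry.inner_map_map _ _ _

variable {φ : ℝ → ℝ}

theorem MemC1per.continuousOn_dx (hl : 0 < l) (hφ : MemC1per l φ) :
    ContinuousOn (dx l φ) (Icc 0 l) :=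
  hφ.1.continuousOn_derivWithin (uniqueDiffOn_Icc hl) le_rfl

/-- The extended derivative g is continuous by periodicity of φ', and has mean zero over a period
since φ(0) = φ(l). Hence φ(0) + ∫₀ᵗ g is periodic; it equals φ on [0,l], so it is the periodic
extension, and no gluing at multiples of l is needed. -/
theorem MemC1per.hasDerivAt_comp_modL (hl : 0 < l) (hφ : MemC1per l φ) (x : ℝ) :
    HasDerivAt (fun x => φ (modL l x)) (dx l φ (modL l x)) x := by
  set g : ℝ → ℝ := fun x => dx l φ (modL l x) with hg
  have hgc : Continuous g := continuous_comp_modL hl (hφ.continuousOn_dx hl) hφ.2.2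
  have hgp : Function.Periodic g l := fun x => by simp only [hg, modL_add_period hl]
  have hac : AbsolutelyContinuousOnInterval φ 0 l := by
    refine ContDiffOn.absolutelyContinuousOnInterval ?_
    rw [uIcc_of_le hl.le]
    exact hφ.1
  have hftc : ∀ t ∈ Icc 0 l, φ t = φ 0 + ∫ s in 0..t, g s := by
    refine eq_add_integral_of_absolutelyContinuous hl.le hac (hgc.intervalIntegrable _ _) ?_
    filter_upwards [ae_restrict_mem measurableSet_Ioo] with t ht
    rw [hg]
    simp only
    rw [modL_eq_self hl (Ioo_subset_Ico_self ht)]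
    exact (((hφ.1.differentiableOn one_ne_zero) t
      (Ioo_subset_Icc_self ht)).hasDerivWithinAt).hasDerivAt (Icc_mem_nhds ht.1 ht.2)
  have hper : Function.Periodic (fun t => φ 0 + ∫ s in 0..t, g s) l := by
    intro t
    have h1 : ∫ s in t..t + l, g s = 0 := by
      rw [hgp.intervalIntegral_add_eq t 0, zero_add]
      have := hftc l ⟨hl.le, le_rfl⟩
      rw [← hφ.2.1] at this
      linarith
    simp only
    rw [← intervalIntegral.integral_add_adjacent_intervals (hgc.intervalIntegrable 0 t)
      (hgc.intervalIntegrable t (t + l)), h1, add_zero]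
  have heq : (fun x => φ (modL l x)) = fun t => φ 0 + ∫ s in 0..t, g s := by
    ext t
    have hm := modL_mem hl t
    rw [hftc _ (Ico_subset_Icc_self hm), modL_eq_sub hl]
    exact hper.sub_int_mul_eq _
  rw [heq]
  exact (hgc.integral_hasStrictDerivAt 0 x).hasDerivAt.const_add _

theorem MemC1per.hasDerivAt_shift (hl : 0 < l) (hφ : MemC1per l φ) (z : ℝ) :
    HasDerivAt (fun ζ => shift l ζ (toH l φ)) (-shift l z (toH l (dx l φ))) z := by
  -- K converts a uniform bound into an L² bound on the finite measure space. The remainder is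
  -- estimated uniformly in x by the mean value inequality and uniform continuity of g.
  set K : ℝ := (measureUnivNNReal (intervalMeasure 0 l) : ℝ) ^ (2 : ℝ≥0∞).toReal⁻¹ with hK
  have hK0 : 0 ≤ K := by positivity
  set g : ℝ → ℝ := fun x => dx l φ (modL l x) with hg
  have hgc : Continuous g := continuous_comp_modL hl (hφ.continuousOn_dx hl) hφ.2.2
  rw [hasDerivAt_iff_isLittleO_nhds_zero, Asymptotics.isLittleO_iff]
  intro c hc
  -- The compact window contains every x - z - s with x in (0,l) and |s| ≤ 1.
  obtain ⟨δ, hδ, hu⟩ := Metric.uniformContinuousOn_iff.mp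
    ((isCompact_Icc (a := -(|z| + 1)) (b := l + |z| + 1)).uniformContinuousOn_of_continuous
      hgc.continuousOn) (c / (K + 1)) (by positivity)
  filter_upwards [Metric.ball_mem_nhds (0 : ℝ) (lt_min hδ one_pos)] with h hh
  rw [mem_ball_zero_iff, Real.norm_eq_abs, lt_min_iff] at hh
  have hbound : ∀ᵐ x ∂(intervalMeasure 0 l),
      ‖(shift l (z + h) (toH l φ) - shift l z (toH l φ) - h • -shift l z (toH l (dx l φ)) : H l) x‖
        ≤ c / (K + 1) * |h| := by
    filter_upwards [coeFn_shift_toH hl hφ.1.continuousOn (z + h),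
      coeFn_shift_toH hl hφ.1.continuousOn z, coeFn_shift_toH hl (hφ.continuousOn_dx hl) z,
      Lp.coeFn_sub (shift l (z + h) (toH l φ) - shift l z (toH l φ))
        (h • -shift l z (toH l (dx l φ))),
      Lp.coeFn_sub (shift l (z + h) (toH l φ)) (shift l z (toH l φ)),
      Lp.coeFn_smul h (-shift l z (toH l (dx l φ))), Lp.coeFn_neg (shift l z (toH l (dx l φ))),
      ae_restrict_mem measurableSet_Ioo] with x h1 h2 h3 h4 h5 h6 h7 hx
    rw [h4, Pi.sub_apply, h5, Pi.sub_apply, h6, Pi.smul_apply, h7, Pi.neg_apply, h1, h2, h3]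
    have hmv := (convex_uIcc 0 h).norm_image_sub_le_of_norm_hasDerivWithin_le
      (f := fun s => φ (modL l (x - z - s)) + s * g (x - z))
      (f' := fun s => -g (x - z - s) + g (x - z)) (C := c / (K + 1)) (x := 0) (y := h) ?_ ?_
      left_mem_uIcc right_mem_uIcc
    · simp only [sub_zero, zero_mul, add_zero, Real.norm_eq_abs] at hmv
      refine le_trans (le_of_eq ?_) hmv
      rw [Real.norm_eq_abs, smul_eq_mul, sub_add_eq_sub_sub]
      congr 1
      simp only [hg]
      ring
    · intro s _
      have hd := (hφ.hasDerivAt_comp_modL hl (x - z - s)).comp_const_sub (x - z) s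
      have hd' := (hd.add ((hasDerivAt_id s).mul_const (g (x - z)))).hasDerivWithinAt (s := uIcc 0 h)
      rw [one_mul] at hd'
      exact hd'
    · intro s hs
      have hsh : |s| ≤ |h| := by
        rcases le_total 0 h with h0 | h0
        · rw [uIcc_of_le h0] at hs
          rw [abs_of_nonneg hs.1, abs_of_nonneg h0]
          exact hs.2
        · rw [uIcc_of_ge h0] at hs
          rw [abs_of_nonpos hs.2, abs_of_nonpos h0]
          linarith [hs.1]
      have hs1 := abs_le.mp (hsh.trans hh.2.le)
      have hz1 := abs_le.mp (le_refl |z|)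
      have := hu (x - z) ⟨by linarith [hx.1], by linarith [hx.2]⟩ (x - z - s)
        ⟨by linarith [hx.1], by linarith [hx.2]⟩ (by
          rw [Real.dist_eq, sub_sub_cancel]
          exact hsh.trans_lt hh.1)
      rw [neg_add_eq_sub, ← dist_eq_norm]
      exact this.le
  refine (Lp.norm_le_of_ae_bound (by positivity) hbound).trans ?_
  rw [← hK, Real.norm_eq_abs]
  have : K * (c / (K + 1) * |h|) = (K / (K + 1)) * (c * |h|) := by ring
  rw [this]
  exact mul_le_of_le_one_left (by positivity) ((div_le_one (by positivity)).mpr (by linarith))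

theorem MemC1per.shiftDeriv_eq (hl : 0 < l) (hφ : MemC1per l φ) (z : ℝ) :
    shiftDeriv l z (toH l φ) = -shift l z (toH l (dx l φ)) :=
  (hφ.hasDerivAt_shift hl z).deriv

theorem MemC1per.lipschitzWith_shift (hl : 0 < l) (hφ : MemC1per l φ) :
    LipschitzWith ‖toH l (dx l φ)‖₊ fun ζ => shift l ζ (toH l φ) := by
  refine lipschitzWith_of_nnnorm_deriv_le
    (fun z => (hφ.hasDerivAt_shift hl z).differentiableAt) fun z => ?_
  rw [(hφ.hasDerivAt_shift hl z).deriv, nnnorm_neg, ← NNReal.coe_le_coe, coe_nnnorm, coe_nnnorm,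
    norm_shift]

/-- Integration by parts against a periodic `H¹` function. -/
theorem MemH1per.exists_inner_shift_dx (hl : 0 < l) {b : H l} (hb : MemH1per l b) :
    ∃ b' : H l, ∀ φ : ℝ → ℝ, MemC1per l φ → ∀ z : ℝ,
      inner ℝ (shift l z (toH l (dx l φ))) b = -inner ℝ (shift l z (toH l φ)) b' := by
  obtain ⟨⟨hbL, g, hgL, hw⟩, f₀, hf₀c, hbf, hf₀⟩ := hb
  have hgi := intervalIntegrable_of_memLp hl.le hgL
  obtain ⟨c, hc⟩ := hw.ae_eq_primitive hl (hbL.integrable one_le_two) (hgL.integrable one_le_two)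
  have hPac := absolutelyContinuousOnInterval_primitive hgi
  set β : ℝ → ℝ := fun x => c + ∫ t in 0..x, g t with hβ
  have hβac : AbsolutelyContinuousOnInterval β 0 l :=
    absolutelyContinuousOnInterval_of_dist_le hPac fun s _ t _ => by simp [hβ]
  have hβc := hβac.continuousOn
  rw [uIcc_of_le hl.le] at hβc
  have hβd : ∀ᵐ t ∂(intervalMeasure 0 l), HasDerivAt β (g t) t := by
    filter_upwards [ae_hasDerivAt_primitive hl.le hgi] with t ht
    exact ht.const_add c
  have hβf : EqOn β f₀ (Icc 0 l) := by
    refine Measure.eqOn_Icc_of_ae_eq volume hl.ne ?_ hβc hf₀c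
    -- Both representatives are continuous up to the boundary, so a.e. equality transfers the
    -- periodicity of f₀ to β.
    rw [← Measure.restrict_congr_set Ioo_ae_eq_Icc]
    exact hc.symm.trans hbf
  have hβl : β 0 = β l := by
    rw [hβf ⟨le_rfl, hl.le⟩, hβf ⟨hl.le, le_rfl⟩, hf₀]
  refine ⟨hgL.toLp g, fun φ hφ z => ?_⟩
  have hΦd : ∀ x, HasDerivAt (fun x => φ (modL l (x - z))) (dx l φ (modL l (x - z))) x :=
    fun x => (hφ.hasDerivAt_comp_modL hl (x - z)).comp_sub_const x z
  have hΦ'c : Continuous fun x => dx l φ (modL l (x - z)) :=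
    (continuous_comp_modL hl (hφ.continuousOn_dx hl) hφ.2.2).comp (continuous_sub_right z)
  have hΦc : Continuous fun x => φ (modL l (x - z)) :=
    continuous_iff_continuousAt.mpr fun x => (hΦd x).continuousAt
  have hΦac : AbsolutelyContinuousOnInterval (fun x => φ (modL l (x - z))) 0 l := by
    refine ContDiffOn.absolutelyContinuousOnInterval (ContDiff.contDiffOn ?_)
    rw [contDiff_one_iff_deriv, funext fun x => (hΦd x).deriv]
    exact ⟨fun x => (hΦd x).differentiableAt, hΦ'c⟩
  have h1 : IntervalIntegrable (fun x => dx l φ (modL l (x - z)) * β x) volume 0 l :=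
    (hΦ'c.continuousOn.mul (by rwa [uIcc_of_le hl.le])).intervalIntegrable
  have h2 : IntervalIntegrable (fun x => φ (modL l (x - z)) * g x) volume 0 l :=
    hgi.continuousOn_mul hΦc.continuousOn
  have key := eq_add_integral_of_absolutelyContinuous
    (f := fun x => φ (modL l (x - z)) * β x) hl.le (hΦac.fun_mul hβac) (h1.add h2) (by
      filter_upwards [hβd] with t ht
      exact (hΦd t).mul ht) l ⟨hl.le, le_rfl⟩
  -- The shifted mode takes equal values at 0 and l, as β does, so the boundary terms cancel.
  have hmod : modL l (l - z) = modL l (0 - z) := by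
    rw [← modL_add_period hl (0 - z)]
    congr 1
    ring
  rw [hmod, ← hβl, left_eq_add, intervalIntegral.integral_add h1 h2,
    intervalIntegral_eq_integral_Ioo hl.le, intervalIntegral_eq_integral_Ioo hl.le] at key
  have e1 : inner ℝ (shift l z (toH l (dx l φ))) b =
      ∫ x in Ioo 0 l, dx l φ (modL l (x - z)) * β x := by
    rw [L2.inner_def]
    refine integral_congr_ae ?_
    filter_upwards [coeFn_shift_toH hl (hφ.continuousOn_dx hl) z, hc] with x hx1 hx2
    rw [hx1, hx2, Real.inner_apply]
  have e2 : inner ℝ (shift l z (toH l φ)) (hgL.toLp g) =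
      ∫ x in Ioo 0 l, φ (modL l (x - z)) * g x := by
    rw [L2.inner_def]
    refine integral_congr_ae ?_
    filter_upwards [coeFn_shift_toH hl hφ.1.continuousOn z, hgL.coeFn_toLp] with x hx1 hx2
    rw [hx1, hx2, Real.inner_apply]
  rw [e1, e2]
  exact eq_neg_of_add_eq_zero_left key

/-- Differentiate the constant function z ↦ ⟨𝒯(z)φ, 𝒯(z)ψ⟩ at z = 0. -/
theorem MemC1per.inner_dx_antisymm (hl : 0 < l) {φ ψ : ℝ → ℝ} (hφ : MemC1per l φ)
    (hψ : MemC1per l ψ) :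
    inner ℝ (toH l φ) (toH l (dx l ψ)) = -inner ℝ (toH l ψ) (toH l (dx l φ)) := by
  have h1 := (hφ.hasDerivAt_shift hl 0).inner ℝ (hψ.hasDerivAt_shift hl 0)
  simp only [inner_shift_shift, inner_neg_left, inner_neg_right] at h1
  have h2 := h1.unique (hasDerivAt_const _ _)
  rw [real_inner_comm (toH l ψ)] at h2
  linarith

end Shift

end SPODG

namespace SPODG

noncomputable section

/-! ### Calculus of bounded Lipschitz maps -/

section BddLip

open scoped NNReal

variable {X Y : Type*} [PseudoMetricSpace X] [PseudoMetricSpace Y]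
  {F₁ F₂ F₃ : Type*} [NormedAddCommGroup F₁] [NormedAddCommGroup F₂] [NormedAddCommGroup F₃]

/-- Bounded and globally Lipschitz maps. -/
def BddLip {F : Type*} [NormedAddCommGroup F] (f : X → F) : Prop :=
  (∃ M : ℝ≥0, ∀ x, ‖f x‖ ≤ M) ∧ ∃ K : ℝ≥0, LipschitzWith K f

theorem BddLip.sub {f g : X → F₁} (hf : BddLip f) (hg : BddLip g) :
    BddLip fun x => f x - g x := by
  obtain ⟨⟨M, hM⟩, K, hK⟩ := hf
  obtain ⟨⟨M', hM'⟩, K', hK'⟩ := hg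
  exact ⟨⟨M + M', fun x => (norm_sub_le _ _).trans (add_le_add (hM x) (hM' x))⟩, _, hK.sub hK'⟩

theorem BddLip.comp {f : Y → F₁} (hf : BddLip f) {h : X → Y} {K : ℝ≥0} (hh : LipschitzWith K h) :
    BddLip fun x => f (h x) := by
  obtain ⟨⟨M, hM⟩, K', hK'⟩ := hf
  exact ⟨⟨M, fun x => hM _⟩, _, hK'.comp hh⟩

theorem BddLip.map {f : X → F₁} (hf : BddLip f) {S : F₁ → F₂} {K : ℝ≥0} (hS : LipschitzWith K S)
    (hS0 : S 0 = 0) : BddLip fun x => S (f x) := by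
  obtain ⟨⟨M, hM⟩, K', hK'⟩ := hf
  refine ⟨⟨K * M, fun x => ?_⟩, _, hS.comp hK'⟩
  have := hS.dist_le_mul (f x) 0
  rw [hS0, dist_zero_right, dist_zero_right] at this
  exact this.trans (mul_le_mul_of_nonneg_left (hM x) K.2)

theorem BddLip.prodMk {f : X → F₁} {g : X → F₂} (hf : BddLip f) (hg : BddLip g) :
    BddLip fun x => (f x, g x) := by
  obtain ⟨⟨M, hM⟩, K, hK⟩ := hf
  obtain ⟨⟨M', hM'⟩, K', hK'⟩ := hg
  refine ⟨⟨max M M', fun x => ?_⟩, _, hK.prodMk hK'⟩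
  rw [Prod.norm_mk, NNReal.coe_max]
  exact max_le_max (hM x) (hM' x)

/-- Closure under products is the reason for pairing boundedness with the Lipschitz condition. -/
theorem BddLip.bilinear [NormedSpace ℝ F₁] [NormedSpace ℝ F₂] [NormedSpace ℝ F₃]
    {P : F₁ × F₂ → F₃} (hP : IsBoundedBilinearMap ℝ P)
    {f : X → F₁} {g : X → F₂} (hf : BddLip f) (hg : BddLip g) : BddLip fun x => P (f x, g x) := by
  obtain ⟨⟨M, hM⟩, K, hK⟩ := hf
  obtain ⟨⟨M', hM'⟩, K', hK'⟩ := hg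
  obtain ⟨C, hC, hb⟩ := hP.bound
  lift C to ℝ≥0 using hC.le
  refine ⟨⟨C * M * M', fun x => (hb _ _).trans ?_⟩, C * K * M' + C * M * K',
    LipschitzWith.of_dist_le_mul fun x y => ?_⟩
  · push_cast
    gcongr
    exacts [hM x, hM' x]
  · have h1 : P (f x, g x) - P (f y, g y) = P (f x - f y, g x) + P (f y, g x - g y) := by
      rw [hP.map_sub_left, hP.map_sub_right]
      abel
    rw [dist_eq_norm, h1]
    refine (norm_add_le _ _).trans ((add_le_add (hb _ _) (hb _ _)).trans ?_)
    rw [← dist_eq_norm, ← dist_eq_norm]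
    push_cast
    rw [add_mul]
    refine add_le_add ?_ ?_
    · calc _ ≤ (C : ℝ) * (K * dist x y) * M' := by
            gcongr
            exacts [hK.dist_le_mul x y, hM' x]
        _ = _ := by ring
    · calc _ ≤ (C : ℝ) * M * (K' * dist x y) := by
            gcongr
            exacts [hM y, hK'.dist_le_mul x y]
        _ = _ := by ring

end BddLip

/-! ### Energy estimate for the norm of α -/

section Energy

variable {W : Type*} [NormedAddCommGroup W] [InnerProductSpace ℝ W]

/-- Away from zeros of α, differentiate ‖α‖² and cancel ‖α‖; at a zero the norm has a minimum, so
its derivative vanishes. -/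
theorem abs_deriv_norm_le {α : ℝ → W} {α' : W} {t k : ℝ} (hα : HasDerivAt α α' t)
    (hd : DifferentiableAt ℝ (fun s => ‖α s‖) t) (hk : 0 ≤ k)
    (h : |inner ℝ (α t) α'| ≤ ‖α t‖ * k) : |deriv (fun s => ‖α s‖) t| ≤ k := by
  by_cases h0 : α t = 0
  · have hmin : IsLocalMin (fun s => ‖α s‖) t :=
      Filter.Eventually.of_forall fun s => by simp [h0]
    rw [hmin.deriv_eq_zero, abs_zero]
    exact hk
  · have hpos : 0 < ‖α t‖ := norm_pos_iff.mpr h0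
    have h1 := (hd.hasDerivAt.pow 2).unique hα.norm_sq
    have h2 : ‖α t‖ * deriv (fun s => ‖α s‖) t = inner ℝ (α t) α' := by
      simp only [Nat.cast_ofNat, Nat.add_one_sub_one, pow_one] at h1
      linarith
    rw [← h2, abs_mul, abs_norm] at h
    exact le_of_mul_le_mul_left h hpos

theorem abs_norm_sub_norm_le_integral {α α' : ℝ → W} {k : ℝ → ℝ} {T : ℝ} (hT : 0 ≤ T)
    (hα : AbsolutelyContinuousOnInterval α 0 T) (hk : IntervalIntegrable k volume 0 T)
    (hk0 : ∀ t, 0 ≤ k t) (hd : ∀ᵐ t ∂(intervalMeasure 0 T), HasDerivAt α (α' t) t)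
    (h : ∀ᵐ t ∂(intervalMeasure 0 T), |inner ℝ (α t) (α' t)| ≤ ‖α t‖ * k t) :
    ∀ t ∈ Icc 0 T, |‖α t‖ - ‖α 0‖| ≤ ∫ s in 0..T, k s := by
  intro t ht
  have hac : AbsolutelyContinuousOnInterval (fun s => ‖α s‖) 0 T :=
    absolutelyContinuousOnInterval_of_dist_le hα fun s _ t _ =>
      (dist_norm_norm_le _ _).trans_eq (dist_eq_norm _ _).symm
  have hsub : uIcc 0 t ⊆ uIcc 0 T := uIcc_subset_uIcc left_mem_uIcc (by rwa [uIcc_of_le hT])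
  rw [← (hac.mono hsub).integral_deriv_eq_sub, ← Real.norm_eq_abs]
  have hae := ae_mem_uIcc_of_ae_intervalMeasure hT (hd.and h)
  refine (intervalIntegral.norm_integral_le_of_norm_le ht.1 ?_ (hk.mono_set hsub)).trans
    (intervalIntegral.integral_mono_interval le_rfl ht.1 ht.2 (ae_of_all _ hk0) hk)
  filter_upwards [hae, hac.ae_differentiableAt] with s h1 h2 hs
  have hs' : s ∈ uIcc 0 T := by
    rw [uIcc_of_le hT]
    exact ⟨hs.1.le, hs.2.trans ht.2⟩
  exact abs_deriv_norm_le (h1 hs').1 (h2 hs') (hk0 s) (h1 hs').2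

/-- Cauchy–Schwarz, read off from ∫(T‖u‖ - I)² ≥ 0. -/
theorem sq_integral_norm_le {V : Type*} [NormedAddCommGroup V] {u : ℝ → V} {T : ℝ} (hT : 0 < T)
    (hu : MemLp u 2 (intervalMeasure 0 T)) :
    (∫ t in Ioo 0 T, ‖u t‖) ^ 2 ≤ T * ∫ t in Ioo 0 T, ‖u t‖ ^ 2 := by
  set I := ∫ t in Ioo 0 T, ‖u t‖
  have h1 : Integrable (fun t => ‖u t‖) (intervalMeasure 0 T) := (hu.integrable one_le_two).norm
  have h2 : Integrable (fun t => ‖u t‖ ^ 2) (intervalMeasure 0 T) := hu.integrable_norm_pow'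
  have h3 : 0 ≤ ∫ t in Ioo 0 T, (T * ‖u t‖ - I) ^ 2 := integral_nonneg fun t => sq_nonneg _
  have h4 : ∫ t in Ioo 0 T, (T * ‖u t‖ - I) ^ 2 =
      T ^ 2 * (∫ t in Ioo 0 T, ‖u t‖ ^ 2) - 2 * T * I * I + T * I ^ 2 := by
    have e : ∀ t, (T * ‖u t‖ - I) ^ 2 = T ^ 2 * ‖u t‖ ^ 2 - 2 * T * I * ‖u t‖ + I ^ 2 :=
      fun t => by ring
    simp only [e]
    have h5 : Integrable (fun t => T ^ 2 * ‖u t‖ ^ 2 - 2 * T * I * ‖u t‖) (intervalMeasure 0 T) :=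
      (h2.const_mul _).sub (h1.const_mul _)
    rw [integral_add h5 (integrable_const _),
      integral_sub (h2.const_mul _) (h1.const_mul _), integral_const_mul, integral_const_mul,
      show ∫ t, ‖u t‖ ∂intervalMeasure 0 T = I from rfl]
    simp [hT.le]
  rw [h4] at h3
  have h5 : 0 ≤ T * (T * (∫ t in Ioo 0 T, ‖u t‖ ^ 2) - I ^ 2) := by nlinarith
  linarith [nonneg_of_mul_nonneg_right h5 hT]

theorem norm_sq_eq_integral {V : Type*} [NormedAddCommGroup V] [InnerProductSpace ℝ V] {a b : ℝ}
    (u : L2 a b V) : ‖u‖ ^ 2 = ∫ t in Ioo a b, ‖u t‖ ^ 2 := by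
  rw [← real_inner_self_eq_norm_sq, L2.inner_def]
  simp only [real_inner_self_eq_norm_sq]

end Energy

/-! ### Truncating the degenerate denominator -/

section Truncation

open scoped NNReal

variable {W V F : Type*} [NormedAddCommGroup W] [InnerProductSpace ℝ W]
  [NormedAddCommGroup V] [NormedSpace ℝ V] [NormedAddCommGroup F] [NormedSpace ℝ F]

/-- The norm of `A α`, truncated from below by `δ`. -/
def truncNorm (A : W →L[ℝ] F) (δ : ℝ) (α : W) : ℝ := max ‖A α‖ δ

/-- The vector `α` divided by the truncated norm of `A α`. -/
def truncDir (A : W →L[ℝ] F) (δ : ℝ) (α : W) : W := (truncNorm A δ α)⁻¹ • α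

/-- The linear functional `u ↦ ⟨w, β₂(z) u⟩ - ⟨N w, β₁(z) u⟩` at the truncated direction `w`. -/
def feedback (N : W →L[ℝ] W) (A : W →L[ℝ] F) (β₁ β₂ : ℝ → V →L[ℝ] W) (δ : ℝ) (x : W × ℝ) :
    V →L[ℝ] ℝ :=
  (innerSL ℝ (truncDir A δ x.1)).comp (β₂ x.2) - (innerSL ℝ (N (truncDir A δ x.1))).comp (β₁ x.2)

/-- The control vector field of the reduced system, made bounded and globally Lipschitz by
truncating the denominator. -/
def truncField (N : W →L[ℝ] W) (A : W →L[ℝ] F) (β₁ β₂ : ℝ → V →L[ℝ] W) (δ : ℝ) (x : W × ℝ) :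
    V →L[ℝ] W × ℝ :=
  (β₁ x.2 - (feedback N A β₁ β₂ δ x).smulRight (N (truncDir A δ x.1))).prod
    ((truncNorm A δ x.1)⁻¹ • feedback N A β₁ β₂ δ x)

variable {N : W →L[ℝ] W} {A : W →L[ℝ] F} {β₁ β₂ : ℝ → V →L[ℝ] W} {δ : ℝ}

theorem truncNorm_pos (hδ : 0 < δ) (α : W) : 0 < truncNorm A δ α := lt_max_of_lt_right hδ

theorem abs_truncNorm_sub_le (α β : W) : |truncNorm A δ α - truncNorm A δ β| ≤ ‖A‖ * dist α β := by
  refine (abs_max_sub_max_le_abs _ _ _).trans ((abs_norm_sub_norm_le _ _).trans ?_)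
  rw [← map_sub, dist_eq_norm]
  exact A.le_opNorm _

/-- One inverse norm is kept instead of being bounded by 1/δ: in `bddLip_truncDir` it must absorb
the unbounded factor ‖β‖. -/
theorem abs_inv_truncNorm_sub_le (hδ : 0 < δ) (α β : W) :
    |(truncNorm A δ α)⁻¹ - (truncNorm A δ β)⁻¹| ≤
      ‖A‖ * dist α β / δ * (truncNorm A δ β)⁻¹ := by
  have hα := truncNorm_pos (A := A) hδ α
  have hβ := truncNorm_pos (A := A) hδ β
  rw [inv_sub_inv hα.ne' hβ.ne', abs_div, abs_mul, abs_of_pos hα, abs_of_pos hβ, ← div_div,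
    div_eq_mul_inv _ (truncNorm A δ β), abs_sub_comm]
  gcongr
  · exact abs_truncNorm_sub_le α β
  · exact le_max_right _ _

theorem bddLip_inv_truncNorm (hδ : 0 < δ) : BddLip fun α : W => (truncNorm A δ α)⁻¹ := by
  have hle : ∀ α : W, (truncNorm A δ α)⁻¹ ≤ δ⁻¹ := fun α =>
    inv_anti₀ hδ (le_max_right _ _)
  refine ⟨⟨⟨δ⁻¹, by positivity⟩, fun α => ?_⟩, ⟨‖A‖ / δ * δ⁻¹, by positivity⟩,
    LipschitzWith.of_dist_le_mul fun α β => ?_⟩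
  · rw [Real.norm_of_nonneg (inv_nonneg.mpr (truncNorm_pos hδ α).le)]
    exact hle α
  · rw [Real.dist_eq]
    refine (abs_inv_truncNorm_sub_le hδ α β).trans ?_
    calc _ ≤ ‖A‖ * dist α β / δ * δ⁻¹ := by
          exact mul_le_mul_of_nonneg_left (hle β) (by positivity)
      _ = ‖A‖ / δ * δ⁻¹ * dist α β := by ring

theorem bddLip_truncDir (hδ : 0 < δ) {κ : ℝ≥0} (hA : ∀ α, ‖α‖ ≤ κ * ‖A α‖) :
    BddLip (truncDir A δ) := by
  have hinv : ∀ α : W, 0 ≤ (truncNorm A δ α)⁻¹ := fun α =>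
    inv_nonneg.mpr (truncNorm_pos hδ α).le
  have hle : ∀ α : W, (truncNorm A δ α)⁻¹ * ‖α‖ ≤ κ := fun α => by
    rw [inv_mul_le_iff₀ (truncNorm_pos hδ α), mul_comm]
    exact (hA α).trans (mul_le_mul_of_nonneg_left (le_max_left _ _) κ.2)
  refine ⟨⟨κ, fun α => ?_⟩, ⟨δ⁻¹ + ‖A‖ / δ * κ, by positivity⟩,
    LipschitzWith.of_dist_le_mul fun α β => ?_⟩
  · rw [truncDir, norm_smul, Real.norm_of_nonneg (hinv α)]
    exact hle α
  · have h1 : truncDir A δ α - truncDir A δ β = (truncNorm A δ α)⁻¹ • (α - β) +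
        ((truncNorm A δ α)⁻¹ - (truncNorm A δ β)⁻¹) • β := by
      simp only [truncDir, smul_sub, sub_smul]
      abel
    rw [dist_eq_norm, h1]
    refine (norm_add_le _ _).trans ?_
    rw [norm_smul, norm_smul, Real.norm_of_nonneg (hinv α), Real.norm_eq_abs, ← dist_eq_norm]
    calc _ ≤ δ⁻¹ * dist α β + ‖A‖ * dist α β / δ * (truncNorm A δ β)⁻¹ * ‖β‖ := by
          gcongr
          · exact le_max_right _ _
          · exact abs_inv_truncNorm_sub_le hδ α β
      _ = δ⁻¹ * dist α β + ‖A‖ * dist α β / δ * ((truncNorm A δ β)⁻¹ * ‖β‖) := by ring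
      _ ≤ δ⁻¹ * dist α β + ‖A‖ * dist α β / δ * κ := by
          gcongr
          exact hle β
      _ = (δ⁻¹ + ‖A‖ / δ * κ) * dist α β := by ring

/-- The quadratic expressions in α divided by ‖Aα‖² are written through the truncated direction,
bounded by κ, and the inverse truncated norm, so the field is built from bounded Lipschitz factors
by bilinear operations. -/
theorem bddLip_truncField (hδ : 0 < δ) {κ : ℝ≥0} (hA : ∀ α, ‖α‖ ≤ κ * ‖A α‖)
    (hβ₁ : BddLip β₁) (hβ₂ : BddLip β₂) : BddLip (truncField N A β₁ β₂ δ) := by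
  have hw : BddLip fun x : W × ℝ => truncDir A δ x.1 :=
    (bddLip_truncDir hδ hA).comp LipschitzWith.prod_fst
  have hNw : BddLip fun x : W × ℝ => N (truncDir A δ x.1) := hw.map N.lipschitz (map_zero N)
  have hi : ∀ {f : W × ℝ → W}, BddLip f → BddLip fun x => innerSL ℝ (f x) := fun hf =>
    hf.map (innerSL ℝ (E := W)).lipschitz (map_zero _)
  have h1 : BddLip fun x : W × ℝ => β₁ x.2 := hβ₁.comp LipschitzWith.prod_snd
  have h2 : BddLip fun x : W × ℝ => β₂ x.2 := hβ₂.comp LipschitzWith.prod_snd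
  have hfb : BddLip (feedback N A β₁ β₂ δ) :=
    ((hi hw).bilinear isBoundedBilinearMap_comp h2).sub
      ((hi hNw).bilinear isBoundedBilinearMap_comp h1)
  have hfst := h1.sub (hfb.bilinear isBoundedBilinearMap_smulRight hNw)
  have hsnd := ((bddLip_inv_truncNorm (A := A) hδ).comp
    (LipschitzWith.prod_fst (β := ℝ))).bilinear isBoundedBilinearMap_smul hfb
  have hprod : LipschitzWith 1 fun p : (V →L[ℝ] W) × (V →L[ℝ] ℝ) => p.1.prod p.2 := by
    refine LipschitzWith.mk_one fun p q => le_of_eq ?_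
    have h : p.1.prod p.2 - q.1.prod q.2 = (p.1 - q.1).prod (p.2 - q.2) := rfl
    rw [dist_eq_norm, h, ContinuousLinearMap.opNorm_prod, dist_eq_norm]
    rfl
  exact (hfst.prodMk hsnd).map hprod rfl

theorem truncField_apply_of_le (hδ : 0 < δ) {α : W} {z s : ℝ} {u : V} (h : δ ≤ ‖A α‖)
    (hs : s * ‖A α‖ ^ 2 = inner ℝ α (β₂ z u) - inner ℝ (N α) (β₁ z u)) :
    truncField N A β₁ β₂ δ (α, z) u = (β₁ z u - s • N α, s) := by
  have hD : truncNorm A δ α = ‖A α‖ := max_eq_left h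
  have hpos : ‖A α‖ ≠ 0 := (hδ.trans_le h).ne'
  have hfb : feedback N A β₁ β₂ δ (α, z) u = s * ‖A α‖ := by
    simp only [feedback, truncDir, hD, sub_apply, ContinuousLinearMap.comp_apply,
      innerSL_apply_apply, map_smul, smul_apply, smul_eq_mul]
    rw [← mul_sub, ← hs]
    field_simp
  simp only [truncField, ContinuousLinearMap.prod_apply, sub_apply,
    ContinuousLinearMap.smulRight_apply, smul_apply, hfb, truncDir, hD, map_smul, smul_smul,
    smul_eq_mul]
  rw [mul_assoc, mul_inv_cancel₀ hpos, mul_one, mul_comm s, ← mul_assoc, inv_mul_cancel₀ hpos,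
    one_mul]

/-- Truncation only rescales the multiple of Nα, which is orthogonal to α, so the energy balance
survives it. -/
theorem inner_truncField_fst (hN : ∀ α, inner ℝ α (N α) = 0) (x : W × ℝ) (u : V) :
    inner ℝ x.1 (truncField N A β₁ β₂ δ x u).1 = inner ℝ x.1 (β₁ x.2 u) := by
  simp [truncField, truncDir, inner_sub_right, inner_smul_right, hN]

end Truncation

end

end SPODG

namespace SPODG

/-! ### Existence and uniqueness for the reduced system -/

section Reduced

open scoped NNReal

variable {n : ℕ} {V F : Type*} [NormedAddCommGroup V] [InnerProductSpace ℝ V]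
  [NormedAddCommGroup F] [NormedSpace ℝ F]

theorem ae_hasDerivAt_euclidean {α : ℝ → EuclideanSpace ℝ (Fin n)} {a b : ℝ} (hab : a ≤ b)
    (hα : AbsolutelyContinuousOnInterval α a b) :
    ∀ᵐ t ∂(intervalMeasure a b), HasDerivAt α (deriv α t) t := by
  have hi : ∀ i, AbsolutelyContinuousOnInterval (fun t => α t i) a b := fun i =>
    absolutelyContinuousOnInterval_of_dist_le hα fun s _ t _ => by
      rw [dist_eq_norm, dist_eq_norm]
      exact PiLp.norm_apply_le (α s - α t) i
  have hall : ∀ᵐ t, ∀ i, t ∈ uIcc a b → DifferentiableAt ℝ (fun t => α t i) t :=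
    ae_all_iff.mpr fun i => (hi i).ae_differentiableAt
  rw [ae_restrict_iff' measurableSet_Ioo]
  filter_upwards [hall] with t ht htI
  refine (differentiableAt_euclidean.mpr fun i => ht i ?_).hasDerivAt
  rw [uIcc_of_le hab]
  exact Ioo_subset_Icc_self htI

/-- Carathéodory solutions of the system `α' = β₁(z) u - (z' - v) N α`,
`(z' - v) ‖A α‖² = ⟨α, β₂(z) u⟩ - ⟨N α, β₁(z) u⟩` with `α(0) = α₀`, `z(0) = z₀`. -/
def IsReducedSolution (N : EuclideanSpace ℝ (Fin n) →L[ℝ] EuclideanSpace ℝ (Fin n))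
    (A : EuclideanSpace ℝ (Fin n) →L[ℝ] F) (β₁ β₂ : ℝ → V →L[ℝ] EuclideanSpace ℝ (Fin n))
    (T v : ℝ) (α₀ : EuclideanSpace ℝ (Fin n)) (z₀ : ℝ) (u : ℝ → V)
    (α : ℝ → EuclideanSpace ℝ (Fin n)) (z : ℝ → ℝ) : Prop :=
  AbsolutelyContinuousOnInterval α 0 T ∧ AbsolutelyContinuousOnInterval z 0 T ∧
  α 0 = α₀ ∧ z 0 = z₀ ∧
  ∀ᵐ t ∂(intervalMeasure 0 T),
    deriv α t = β₁ (z t) (u t) - (deriv z t - v) • N (α t) ∧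
    (deriv z t - v) * ‖A (α t)‖ ^ 2 =
      inner ℝ (α t) (β₂ (z t) (u t)) - inner ℝ (N (α t)) (β₁ (z t) (u t))

variable {N : EuclideanSpace ℝ (Fin n) →L[ℝ] EuclideanSpace ℝ (Fin n)}
  {A : EuclideanSpace ℝ (Fin n) →L[ℝ] F} {β₁ β₂ : ℝ → V →L[ℝ] EuclideanSpace ℝ (Fin n)}
  {T v c r : ℝ} {α₀ : EuclideanSpace ℝ (Fin n)} {z₀ : ℝ} {u : ℝ → V}

theorem le_norm_of_inner_deriv_eq (hT : 0 ≤ T) (hc : 0 ≤ c)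
    (hβ : ∀ z α u, |inner ℝ α (β₁ z u)| ≤ ‖α‖ * (c * ‖u‖))
    (hu : IntervalIntegrable u volume 0 T) (hr : ∫ t in 0..T, c * ‖u t‖ ≤ ‖α₀‖ - r)
    {α α' : ℝ → EuclideanSpace ℝ (Fin n)} {z : ℝ → ℝ} (h0 : α 0 = α₀)
    (hα : AbsolutelyContinuousOnInterval α 0 T)
    (hd : ∀ᵐ t ∂(intervalMeasure 0 T), HasDerivAt α (α' t) t)
    (h : ∀ᵐ t ∂(intervalMeasure 0 T), inner ℝ (α t) (α' t) = inner ℝ (α t) (β₁ (z t) (u t))) :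
    ∀ t ∈ Icc 0 T, r ≤ ‖α t‖ := by
  intro t ht
  have := abs_norm_sub_norm_le_integral hT hα (hu.norm.const_mul c) (fun t => by positivity) hd (by
    filter_upwards [h] with s hs
    rw [hs]
    exact hβ _ _ _) t ht
  rw [h0] at this
  linarith [(abs_le.mp (this.trans hr)).1]

/-- The energy bound keeps ‖α‖ ≥ r, hence ‖Aα‖ ≥ r/κ, for the truncated and the original equation,
so Picard's theorem for the truncated field settles both existence and uniqueness. -/
theorem exists_reduced_solution (hT : 0 ≤ T) (hc : 0 ≤ c) (hr0 : 0 < r)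
    (hN : ∀ α, inner ℝ α (N α) = 0) {κ : ℝ≥0} (hκ : 0 < κ) (hA : ∀ α, ‖α‖ ≤ κ * ‖A α‖)
    (hβ₁ : BddLip β₁) (hβ₂ : BddLip β₂)
    (hβ : ∀ z α u, |inner ℝ α (β₁ z u)| ≤ ‖α‖ * (c * ‖u‖))
    (hu : IntervalIntegrable u volume 0 T) (hr : ∫ t in 0..T, c * ‖u t‖ ≤ ‖α₀‖ - r)
    {M : ℝ} (hM : ∀ x, ‖truncField N A β₁ β₂ (r / κ) x‖ ≤ M) :
    ∃ (α : ℝ → EuclideanSpace ℝ (Fin n)) (z : ℝ → ℝ),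
      IsReducedSolution N A β₁ β₂ T v α₀ z₀ u α z ∧
      (∀ (β : ℝ → EuclideanSpace ℝ (Fin n)) (w : ℝ → ℝ),
        IsReducedSolution N A β₁ β₂ T v α₀ z₀ u β w → EqOn β α (Icc 0 T) ∧ EqOn w z (Icc 0 T)) ∧
      (∀ t ∈ Icc 0 T, ‖α t‖ ≤ ‖α₀‖ + ∫ s in 0..T, (|v| + M * ‖u s‖)) ∧
      (∀ t ∈ Icc 0 T, ‖z t‖ ≤ |z₀| + ∫ s in 0..T, (|v| + M * ‖u s‖)) ∧
      ∃ g : ℝ → EuclideanSpace ℝ (Fin n) × ℝ, IntervalIntegrable g volume 0 T ∧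
        (∀ᵐ t ∂(intervalMeasure 0 T), HasDerivAt α (g t).1 t ∧ HasDerivAt z (g t).2 t) ∧
        ∀ t, ‖g t‖ ≤ |v| + M * ‖u t‖ := by
  have hδ : 0 < r / κ := by positivity
  have hAr : ∀ α, r ≤ ‖α‖ → r / κ ≤ ‖A α‖ := fun α h => by
    rw [div_le_iff₀ (by positivity), mul_comm]
    exact h.trans (hA α)
  obtain ⟨L, hL⟩ := (bddLip_truncField (N := N) hδ hA hβ₁ hβ₂).2
  set G := truncField N A β₁ β₂ (r / κ) with hG
  obtain ⟨x, hxc, hx, hxu⟩ := exists_unique_integral_solution hL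
    ((0 : EuclideanSpace ℝ (Fin n)), v) (α₀, z₀) hT hu
  set g : ℝ → EuclideanSpace ℝ (Fin n) × ℝ := fun s => (0, v) + G (x s) (u s) with hg
  have hgi : IntervalIntegrable g volume 0 T :=
    intervalIntegrable_affine_control hL.continuous _ hT hu hxc
  have hgM : ∀ t, ‖g t‖ ≤ |v| + M * ‖u t‖ := fun t => by
    refine (norm_add_le _ _).trans (add_le_add (by simp) ?_)
    exact ((G (x t)).le_opNorm _).trans (mul_le_mul_of_nonneg_right (hM _) (norm_nonneg _))
  have hMi : IntervalIntegrable (fun t => |v| + M * ‖u t‖) volume 0 T :=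
    intervalIntegrable_const.add (hu.norm.const_mul M)
  have hx0 : x 0 = (α₀, z₀) := by simpa using hx 0 ⟨le_rfl, hT⟩
  have hxac : AbsolutelyContinuousOnInterval x 0 T := by
    refine absolutelyContinuousOnInterval_of_dist_le
      (absolutelyContinuousOnInterval_primitive hgi) fun s hs t ht => ?_
    rw [uIcc_of_le hT] at hs ht
    rw [hx s hs, hx t ht, dist_add_left]
  have hxd : ∀ᵐ t ∂(intervalMeasure 0 T), HasDerivAt x (g t) t := by
    filter_upwards [ae_hasDerivAt_primitive hT hgi, ae_restrict_mem measurableSet_Ioo] with t h1 h2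
    refine (h1.const_add (α₀, z₀)).congr_of_eventuallyEq ?_
    filter_upwards [Icc_mem_nhds h2.1 h2.2] with s hs using hx s hs
  have hα : AbsolutelyContinuousOnInterval (fun t => (x t).1) 0 T :=
    absolutelyContinuousOnInterval_of_dist_le hxac fun s _ t _ => le_max_left _ _
  have hz : AbsolutelyContinuousOnInterval (fun t => (x t).2) 0 T :=
    absolutelyContinuousOnInterval_of_dist_le hxac fun s _ t _ => le_max_right _ _
  have hd : ∀ᵐ t ∂(intervalMeasure 0 T),
      HasDerivAt (fun t => (x t).1) (g t).1 t ∧ HasDerivAt (fun t => (x t).2) (g t).2 t := by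
    filter_upwards [hxd] with t ht using ⟨ht.fst, ht.snd⟩
  -- The bound is obtained before x is known to solve the original system, from the truncated energy
  -- balance alone.
  have hlow := le_norm_of_inner_deriv_eq (z := fun t => (x t).2) hT hc hβ hu hr
    (congrArg Prod.fst hx0) hα (hd.mono fun t ht => ht.1) (ae_of_all _ fun t => by
      simp only [hg, Prod.fst_add, zero_add]
      exact inner_truncField_fst hN _ _)
  refine ⟨fun t => (x t).1, fun t => (x t).2, ⟨hα, hz, congrArg Prod.fst hx0,
    congrArg Prod.snd hx0, ?_⟩, fun β w hs => ?_, fun t ht => ?_, fun t ht => ?_, g, hgi, hd, hgM⟩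
  · filter_upwards [hd, ae_restrict_mem measurableSet_Ioo] with t ht htI
    have hle := hAr _ (hlow t (Ioo_subset_Icc_self htI))
    have hne : ‖A (x t).1‖ ^ 2 ≠ 0 := pow_ne_zero 2 (hδ.trans_le hle).ne'
    have key := truncField_apply_of_le (N := N) (β₁ := β₁) (β₂ := β₂) (z := (x t).2) (u := u t)
      hδ hle (div_mul_cancel₀ _ hne)
    rw [ht.1.deriv, ht.2.deriv]
    simp only [hg, hG, Prod.fst_add, Prod.snd_add, zero_add, add_sub_cancel_left]
    rw [show x t = ((x t).1, (x t).2) from rfl, key]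
    exact ⟨rfl, div_mul_cancel₀ _ hne⟩
  -- Any competitor stays above the threshold too, so it solves the truncated integral equation and
  -- Picard uniqueness applies.
  · obtain ⟨hβac, hwac, hβ0, hw0, hode⟩ := hs
    have hβd := ae_hasDerivAt_euclidean hT hβac
    have hwd : ∀ᵐ t ∂(intervalMeasure 0 T), HasDerivAt w (deriv w t) t := by
      rw [ae_restrict_iff' measurableSet_Ioo]
      filter_upwards [hwac.ae_differentiableAt] with t ht htI
      refine (ht ?_).hasDerivAt
      rw [uIcc_of_le hT]
      exact Ioo_subset_Icc_self htI
    have hlow' := le_norm_of_inner_deriv_eq (z := w) hT hc hβ hu hr hβ0 hβac hβd (by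
      filter_upwards [hode] with t ht
      rw [ht.1, inner_sub_right, inner_smul_right, hN, mul_zero, sub_zero])
    have hyac := absolutelyContinuousOnInterval_prodMk hβac hwac
    have hyc := hyac.continuousOn
    rw [uIcc_of_le hT] at hyc
    have hy := hxu (fun t => (β t, w t)) hyc (fun t ht => by
      have := eq_add_integral_of_absolutelyContinuous hT hyac
        (intervalIntegrable_affine_control hL.continuous (0, v) hT hu hyc) (by
          filter_upwards [hβd, hwd, hode, ae_restrict_mem measurableSet_Ioo] with s h1 h2 h3 hs
          have key := truncField_apply_of_le hδ (hAr _ (hlow' s (Ioo_subset_Icc_self hs))) h3.2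
          rw [hG, key, Prod.mk_add_mk, zero_add, add_sub_cancel, ← h3.1]
          exact h1.prodMk h2) t ht
      simpa only [hβ0, hw0] using this)
    exact ⟨fun t ht => congrArg Prod.fst (hy ht), fun t ht => congrArg Prod.snd (hy ht)⟩
  all_goals
    have hI : ‖∫ s in 0..t, g s‖ ≤ ∫ s in 0..T, (|v| + M * ‖u s‖) := by
      refine (intervalIntegral.norm_integral_le_of_norm_le ht.1 (ae_of_all _ fun s _ => hgM s)
        (hMi.mono_set (uIcc_subset_uIcc left_mem_uIcc (by rwa [uIcc_of_le hT])))).trans ?_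
      exact intervalIntegral.integral_mono_interval le_rfl ht.1 ht.2
        (ae_of_all _ fun s => (norm_nonneg _).trans (hgM s)) hMi
    simp only [hx t ht]
  · exact (norm_add_le _ _).trans (add_le_add le_rfl ((norm_fst_le _).trans hI))
  · exact (norm_add_le _ _).trans (add_le_add le_rfl ((norm_snd_le _).trans hI))

end Reduced

/-! ### Synthesis operators and their adjoints -/

section Operators

variable {l : ℝ} {n m : ℕ}

theorem controlOp_apply (b : Fin m → H l) (u : U m) : controlOp b u = ∑ k, u k • b k := by
  simp [controlOp]

theorem controlOp_single (b : Fin m → H l) (k : Fin m) :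
    controlOp b (EuclideanSpace.single k 1) = b k := by
  rw [controlOp_apply, Finset.sum_eq_single k] <;> simp +contextual

theorem adjoint_controlOp_apply (h : Fin n → H l) (x : H l) (i : Fin n) :
    (ContinuousLinearMap.adjoint (controlOp h) x) i = inner ℝ (h i) x := by
  rw [← controlOp_single h i, ← ContinuousLinearMap.adjoint_inner_right,
    EuclideanSpace.inner_single_left]
  simp

theorem sum_inner_single_mul (x : H l) (B : U m →L[ℝ] H l) (u : U m) :
    ∑ j, inner ℝ x (B (EuclideanSpace.single j 1)) * u j = inner ℝ x (B u) := by
  have hu : u = ∑ j, u j • EuclideanSpace.single j (1 : ℝ) := by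
    ext i
    simp [Finset.sum_apply, Pi.single_apply]
  conv_rhs => rw [hu]
  simp only [map_sum, map_smul, inner_sum, inner_smul_right]
  exact Finset.sum_congr rfl fun j _ => mul_comm _ _

theorem norm_controlOp_of_orthonormal {h : Fin n → H l} (hh : Orthonormal ℝ h)
    (α : EuclideanSpace ℝ (Fin n)) : ‖controlOp h α‖ = ‖α‖ := by
  rw [← sq_eq_sq₀ (norm_nonneg _) (norm_nonneg _), ← real_inner_self_eq_norm_sq, controlOp_apply,
    hh.inner_sum, EuclideanSpace.norm_sq_eq]
  exact Finset.sum_congr rfl fun i _ => by simp [sq]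

theorem orthonormal_shift {h : Fin n → H l} (hh : Orthonormal ℝ h) (z : ℝ) :
    Orthonormal ℝ fun i => shift l z (h i) :=
  hh.comp_linearIsometry (Lp.compMeasurePreservingₗᵢ ℝ (shiftPoint l z)
    (measurePreserving_shiftPoint l z))

end Operators

end SPODG

namespace SPODG

noncomputable section

open scoped NNReal

/-! ### The Galerkin matrices as operators -/

section Galerkin

variable {l : ℝ} {n m : ℕ}

theorem ofLp_dotProduct_ofLp {k : ℕ} (x y : EuclideanSpace ℝ (Fin k)) :
    x.ofLp ⬝ᵥ y.ofLp = inner ℝ x y := by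
  rw [EuclideanSpace.inner_eq_star_dotProduct, dotProduct_comm]
  rfl

/-- The matrix `N` as an operator. -/
def opN (l : ℝ) (φ : Fin n → ℝ → ℝ) : EuclideanSpace ℝ (Fin n) →L[ℝ] EuclideanSpace ℝ (Fin n) :=
  -(ContinuousLinearMap.adjoint (controlOp fun i => toH l (φ i))).comp
    (controlOp fun i => toH l (dx l (φ i)))

/-- The component of `∑ᵢ αᵢ φᵢ'` orthogonal to the span of the modes `φᵢ`. -/
def opA (l : ℝ) (φ : Fin n → ℝ → ℝ) : EuclideanSpace ℝ (Fin n) →L[ℝ] H l :=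
  controlOp (fun i => toH l (dx l (φ i))) + (controlOp fun i => toH l (φ i)).comp (opN l φ)

/-- The operator `u ↦ (⟨𝒯(z)φᵢ, B u⟩)ᵢ`. -/
def shiftTest (l : ℝ) (φ : Fin n → ℝ → ℝ) (B : U m →L[ℝ] H l) (z : ℝ) :
    U m →L[ℝ] EuclideanSpace ℝ (Fin n) :=
  (ContinuousLinearMap.adjoint (controlOp fun i => shift l z (toH l (φ i)))).comp B

variable {φ : Fin n → ℝ → ℝ}

theorem opN_apply (α : EuclideanSpace ℝ (Fin n)) (i : Fin n) :
    opN l φ α i = -inner ℝ (toH l (φ i)) (controlOp (fun i => toH l (dx l (φ i))) α) := by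
  rw [← adjoint_controlOp_apply (fun i => toH l (φ i))]
  rfl

theorem matN_mulVec (α : EuclideanSpace ℝ (Fin n)) :
    matN l φ *ᵥ α.ofLp = (opN l φ α).ofLp := by
  ext i
  rw [opN_apply, controlOp_apply, inner_sum, ← Finset.sum_neg_distrib]
  simp only [Matrix.mulVec, dotProduct]
  refine Finset.sum_congr rfl fun j _ => ?_
  rw [inner_smul_right]
  simp only [matN, Matrix.of_apply]
  ring

theorem dotProduct_matM2_mulVec (α : EuclideanSpace ℝ (Fin n)) :
    α.ofLp ⬝ᵥ (matM2 l φ *ᵥ α.ofLp) =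
      ‖controlOp (fun i => toH l (dx l (φ i))) α‖ ^ 2 := by
  rw [← real_inner_self_eq_norm_sq, controlOp_apply, sum_inner]
  simp only [Matrix.mulVec, dotProduct]
  refine Finset.sum_congr rfl fun i _ => ?_
  rw [inner_smul_left, inner_sum]
  congr 1
  refine Finset.sum_congr rfl fun j _ => ?_
  rw [inner_smul_right, mul_comm]
  rfl

theorem matB1_mulVec (b : Fin m → H l) (z : ℝ) (u : U m) :
    matB1 l φ b z *ᵥ u.ofLp = (shiftTest l φ (controlOp b) z u).ofLp := by
  ext i
  rw [shiftTest, ContinuousLinearMap.comp_apply, adjoint_controlOp_apply, ← sum_inner_single_mul]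
  rfl

theorem matB2_mulVec (hl : 0 < l) (hφ : ∀ i, MemC1per l (φ i)) {b b' : Fin m → H l}
    (hb : ∀ k, ∀ φ : ℝ → ℝ, MemC1per l φ → ∀ z : ℝ,
      inner ℝ (shift l z (toH l (dx l φ))) (b k) = -inner ℝ (shift l z (toH l φ)) (b' k))
    (z : ℝ) (u : U m) :
    matB2 l φ b z *ᵥ u.ofLp = (shiftTest l φ (controlOp b') z u).ofLp := by
  ext i
  rw [shiftTest, ContinuousLinearMap.comp_apply, adjoint_controlOp_apply, ← sum_inner_single_mul]
  simp only [Matrix.mulVec, dotProduct]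
  refine Finset.sum_congr rfl fun j _ => ?_
  simp only [matB2, Matrix.of_apply, controlOp_single, (hφ i).shiftDeriv_eq hl, inner_neg_left,
    hb j _ (hφ i), neg_neg]

theorem inner_opN_self (hl : 0 < l) (hφ : ∀ i, MemC1per l (φ i)) (α : EuclideanSpace ℝ (Fin n)) :
    inner ℝ α (opN l φ α) = 0 := by
  have h : inner ℝ α (opN l φ α) = -∑ i, ∑ j, α i * α j *
      inner ℝ (toH l (φ i)) (toH l (dx l (φ j))) := by
    simp only [opN, neg_apply, ContinuousLinearMap.comp_apply, inner_neg_right,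
      ContinuousLinearMap.adjoint_inner_right, controlOp_apply, sum_inner, inner_sum,
      inner_smul_left, inner_smul_right, RCLike.conj_to_real]
    rw [Finset.sum_comm]
    simp only [Finset.mul_sum]
    rw [neg_inj]
    refine Finset.sum_congr rfl fun i _ => Finset.sum_congr rfl fun j _ => ?_
    ring
  have h2 : ∑ i, ∑ j, α i * α j * inner ℝ (toH l (φ i)) (toH l (dx l (φ j))) =
      -∑ i, ∑ j, α i * α j * inner ℝ (toH l (φ i)) (toH l (dx l (φ j))) := by
    conv_lhs => rw [Finset.sum_comm]
    simp only [← Finset.sum_neg_distrib]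
    refine Finset.sum_congr rfl fun i _ => Finset.sum_congr rfl fun j _ => ?_
    rw [(hφ j).inner_dx_antisymm hl (hφ i)]
    ring
  rw [h]
  linarith

/-- Pythagoras: the entries of -Nα are the coefficients of the projection of ∑ αᵢφᵢ' onto span(φᵢ).
-/
theorem norm_opA_sq (hortho : Orthonormal ℝ (fun i => toH l (φ i)))
    (α : EuclideanSpace ℝ (Fin n)) :
    ‖opA l φ α‖ ^ 2 =
      ‖controlOp (fun i => toH l (dx l (φ i))) α‖ ^ 2 - ‖opN l φ α‖ ^ 2 := by
  have h1 : inner ℝ (controlOp (fun i => toH l (dx l (φ i))) α)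
      (controlOp (fun i => toH l (φ i)) (opN l φ α)) = -‖opN l φ α‖ ^ 2 := by
    rw [← ContinuousLinearMap.adjoint_inner_left, ← real_inner_self_eq_norm_sq, ← inner_neg_left]
    congr 1
    simp [opN]
  simp only [opA, add_apply, ContinuousLinearMap.comp_apply]
  rw [norm_add_sq_real, h1, norm_controlOp_of_orthonormal hortho]
  ring

/-- A kernel vector gives a linear relation among the φᵢ and φᵢ' with coefficients Nα and α. -/
theorem opA_injective (hlin : LinearIndependent ℝ
    (Sum.elim (fun i => toH l (φ i)) (fun i => toH l (dx l (φ i))))) (α : EuclideanSpace ℝ (Fin n))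
    (h : opA l φ α = 0) : α = 0 := by
  have h1 := Fintype.linearIndependent_iff.mp hlin (Sum.elim (opN l φ α) α) (by
    rw [Fintype.sum_sum_type, add_comm]
    simpa [opA, controlOp_apply] using h)
  ext i
  exact h1 (Sum.inr i)

theorem exists_norm_le_opA (hlin : LinearIndependent ℝ
    (Sum.elim (fun i => toH l (φ i)) (fun i => toH l (dx l (φ i))))) :
    ∃ κ : ℝ≥0, 0 < κ ∧ ∀ α, ‖α‖ ≤ κ * ‖opA l φ α‖ := by
  obtain ⟨κ, hκ, h⟩ := LinearMap.exists_antilipschitzWith (opA l φ).toLinearMap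
    (LinearMap.ker_eq_bot'.mpr (opA_injective hlin))
  refine ⟨κ, hκ, fun α => ?_⟩
  simpa using h.le_mul_dist α 0

/-- Block elimination: substituting α̇ into ⟨Nα, α̇⟩ leaves the Schur complement as the coefficient
of ż - v. -/
theorem romEquation_iff (hl : 0 < l) (hφ : ∀ i, MemC1per l (φ i))
    (hortho : Orthonormal ℝ (fun i => toH l (φ i))) {b b' : Fin m → H l}
    (hb : ∀ k, ∀ φ : ℝ → ℝ, MemC1per l φ → ∀ z : ℝ,
      inner ℝ (shift l z (toH l (dx l φ))) (b k) = -inner ℝ (shift l z (toH l φ)) (b' k))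
    (v : ℝ) (α : EuclideanSpace ℝ (Fin n)) (z : ℝ) (dα : EuclideanSpace ℝ (Fin n)) (dz : ℝ)
    (u : U m) :
    ROMEquation l φ b v α.ofLp z dα.ofLp dz u.ofLp ↔
      dα = shiftTest l φ (controlOp b) z u - (dz - v) • opN l φ α ∧
      (dz - v) * ‖opA l φ α‖ ^ 2 = inner ℝ α (shiftTest l φ (controlOp b') z u) -
        inner ℝ (opN l φ α) (shiftTest l φ (controlOp b) z u) := by
  rw [ROMEquation, Matrix.dotProduct_mulVec, Matrix.vecMul_transpose, matN_mulVec,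
    dotProduct_matM2_mulVec, matB1_mulVec, matB2_mulVec hl hφ hb, ofLp_dotProduct_ofLp,
    ofLp_dotProduct_ofLp, norm_opA_sq hortho]
  have h1 : dα.ofLp + dz • (opN l φ α).ofLp =
        v • (opN l φ α).ofLp + (shiftTest l φ (controlOp b) z u).ofLp ↔
      dα = shiftTest l φ (controlOp b) z u - (dz - v) • opN l φ α := by
    refine ((WithLp.ofLp_injective 2).eq_iff (a := dα + dz • opN l φ α)
      (b := v • opN l φ α + shiftTest l φ (controlOp b) z u)).trans ?_
    rw [← eq_sub_iff_add_eq, sub_smul]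
    refine iff_of_eq (congrArg _ ?_)
    abel
  rw [h1]
  refine and_congr_right fun h => ?_
  rw [h, inner_sub_right, inner_smul_right, real_inner_self_eq_norm_sq]
  constructor <;> intro h2 <;> linarith

/-- Boundedness holds because shifted modes stay orthonormal; the Lipschitz constants of the
individual shifted modes add up. -/
theorem bddLip_shiftTest (hl : 0 < l) (hφ : ∀ i, MemC1per l (φ i))
    (hortho : Orthonormal ℝ (fun i => toH l (φ i))) (B : U m →L[ℝ] H l) :
    BddLip (shiftTest l φ B) := by
  have h1 : BddLip fun z => controlOp fun i => shift l z (toH l (φ i)) := by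
    refine ⟨⟨1, fun z => ContinuousLinearMap.opNorm_le_bound _ zero_le_one fun α => ?_⟩,
      ∑ i, ‖toH l (dx l (φ i))‖₊, LipschitzWith.of_dist_le_mul fun z w => ?_⟩
    · rw [norm_controlOp_of_orthonormal (orthonormal_shift hortho z), NNReal.coe_one, one_mul]
    · rw [dist_eq_norm]
      refine ContinuousLinearMap.opNorm_le_bound _ (by positivity) fun α => ?_
      rw [sub_apply, controlOp_apply, controlOp_apply, ← Finset.sum_sub_distrib]
      refine (norm_sum_le _ _).trans ?_
      push_cast
      rw [Finset.sum_mul, Finset.sum_mul]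
      refine Finset.sum_le_sum fun i _ => ?_
      rw [← smul_sub, norm_smul, mul_comm, ← dist_eq_norm]
      exact mul_le_mul ((hφ i).lipschitzWith_shift hl |>.dist_le_mul z w) (PiLp.norm_apply_le α i)
        (norm_nonneg _) (by positivity)
  have hadj : LipschitzWith 1 fun f : EuclideanSpace ℝ (Fin n) →L[ℝ] H l =>
      ContinuousLinearMap.adjoint f :=
    LipschitzWith.mk_one fun f g =>
      (ContinuousLinearMap.adjoint.dist_map f g).le
  have hB : BddLip fun _ : ℝ => B :=
    ⟨⟨‖B‖₊, fun _ => le_rfl⟩, 0, LipschitzWith.const B⟩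
  exact (h1.map hadj (map_zero _)).bilinear isBoundedBilinearMap_comp hB

theorem abs_inner_shiftTest_le (hortho : Orthonormal ℝ (fun i => toH l (φ i)))
    (B : U m →L[ℝ] H l) (z : ℝ) (α : EuclideanSpace ℝ (Fin n)) (u : U m) :
    |inner ℝ α (shiftTest l φ B z u)| ≤ ‖α‖ * (‖B‖ * ‖u‖) := by
  rw [shiftTest, ContinuousLinearMap.comp_apply, ContinuousLinearMap.adjoint_inner_right]
  refine (abs_real_inner_le_norm _ _).trans ?_
  rw [norm_controlOp_of_orthonormal (orthonormal_shift hortho z)]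
  exact mul_le_mul_of_nonneg_left (B.le_opNorm u) (norm_nonneg _)

theorem isCaratheodorySolution_iff (hl : 0 < l) (hφ : ∀ i, MemC1per l (φ i))
    (hortho : Orthonormal ℝ (fun i => toH l (φ i))) {b b' : Fin m → H l}
    (hb : ∀ k, ∀ φ : ℝ → ℝ, MemC1per l φ → ∀ z : ℝ,
      inner ℝ (shift l z (toH l (dx l φ))) (b k) = -inner ℝ (shift l z (toH l φ)) (b' k))
    {T v : ℝ} {α₀ : EuclideanSpace ℝ (Fin n)} {z₀ : ℝ} {u : L2 0 T (U m)}
    {α : ℝ → EuclideanSpace ℝ (Fin n)} {z : ℝ → ℝ} :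
    IsCaratheodorySolution l φ b T v α₀ z₀ u α z ↔
      IsReducedSolution (opN l φ) (opA l φ) (shiftTest l φ (controlOp b))
        (shiftTest l φ (controlOp b')) T v α₀ z₀ u α z := by
  simp only [IsCaratheodorySolution, IsReducedSolution, romEquation_iff hl hφ hortho hb]

end Galerkin

/-! ### Uniform H¹ bounds and conclusion -/

theorem memH1_and_h1Norm_le {E V : Type*} [NormedAddCommGroup E] [NormedSpace ℝ E]
    [CompleteSpace E] [NormedAddCommGroup V] {f g : ℝ → E} {u : ℝ → V} {T A v M R : ℝ}
    (hT : 0 ≤ T) (hf : AbsolutelyContinuousOnInterval f 0 T)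
    (hg : AEStronglyMeasurable g (intervalMeasure 0 T))
    (h : ∀ᵐ t ∂(intervalMeasure 0 T), HasDerivAt f (g t) t)
    (hA : ∀ t ∈ Icc 0 T, ‖f t‖ ≤ A) (hu : MemLp u 2 (intervalMeasure 0 T))
    (hR : ∫ t in Ioo 0 T, ‖u t‖ ^ 2 ≤ R) (hgu : ∀ t, ‖g t‖ ≤ |v| + M * ‖u t‖) :
    MemH1 0 T f ∧
      h1Norm 0 T f ≤ Real.sqrt (A ^ 2 * T + (2 * v ^ 2 * T + 2 * M ^ 2 * R)) := by
  have hgL : MemLp g 2 (intervalMeasure 0 T) := by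
    refine MemLp.of_le ((memLp_const |v|).add (hu.norm.const_mul M)) hg
      (ae_of_all _ fun t => (hgu t).trans (le_abs_self _))
  refine ⟨memH1_of_absolutelyContinuous hT hf hgL h,
    (h1Norm_le_of_absolutelyContinuous hT hf hgL h hA).trans (Real.sqrt_le_sqrt ?_)⟩
  rw [sub_zero]
  refine add_le_add le_rfl ?_
  have hui : Integrable (fun t => ‖u t‖ ^ 2) (intervalMeasure 0 T) := hu.integrable_norm_pow'
  have hle : ∫ t in Ioo 0 T, ‖g t‖ ^ 2 ≤
      ∫ t in Ioo 0 T, (2 * v ^ 2 + 2 * M ^ 2 * ‖u t‖ ^ 2) := by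
    refine integral_mono hgL.integrable_norm_pow'
      ((integrable_const _).add (hui.const_mul _)) fun t => ?_
    calc ‖g t‖ ^ 2 ≤ (|v| + M * ‖u t‖) ^ 2 := pow_le_pow_left₀ (norm_nonneg _) (hgu t) 2
      _ ≤ 2 * (|v| ^ 2 + (M * ‖u t‖) ^ 2) := add_sq_le
      _ = _ := by rw [sq_abs]; ring
  refine hle.trans ?_
  rw [integral_add (integrable_const _) (hui.const_mul _),
    integral_const_mul (2 * M ^ 2) (fun t => ‖u t‖ ^ 2)]
  refine add_le_add (le_of_eq ?_) (mul_le_mul_of_nonneg_left hR (by positivity : 0 ≤ 2 * M ^ 2))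
  simp [hT]
  ring

/-- The smallness condition enters only through e·n ≥ 9/4 = (3/2)²; the remaining third of ‖α₀‖ is
the lower bound for ‖α‖. -/
theorem mul_le_two_thirds_of_sq_lt {c T a I s : ℝ} {n : ℕ} (hn : 0 < n) (hc : 0 ≤ c) (hT : 0 < T)
    (ha : 0 ≤ a) (hI : I ^ 2 ≤ T * s) (hs : s < a ^ 2 / (c ^ 2 * Real.exp 1 * T * n)) :
    c * I ≤ 2 / 3 * a := by
  rcases hc.eq_or_lt with rfl | hc
  · rw [zero_mul]
    positivity
  have hn1 : (1 : ℝ) ≤ n := by exact_mod_cast hn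
  have he : (9 / 4 : ℝ) ≤ Real.exp 1 := by linarith [Real.exp_one_gt_d9]
  have hs0 : 0 ≤ s := nonneg_of_mul_nonneg_right ((sq_nonneg I).trans hI) hT
  refine (le_abs_self _).trans (abs_le_of_sq_le_sq ?_ (by positivity))
  rw [lt_div_iff₀ (by positivity)] at hs
  have h1 : c ^ 2 * I ^ 2 ≤ c ^ 2 * (T * s) := mul_le_mul_of_nonneg_left hI (by positivity)
  have h2 : 9 / 4 * (c ^ 2 * (T * s)) ≤ Real.exp 1 * n * (c ^ 2 * (T * s)) := by
    refine mul_le_mul_of_nonneg_right ?_ (by positivity)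
    nlinarith
  nlinarith

end

end SPODG

open SPODG in
theorem theorem3p1
    {n m : ℕ} (hm : 0 < m) (l T v : ℝ) (hl : 0 < l) (hT : 0 < T)
    (φ : Fin n → ℝ → ℝ) (hφ : ∀ i, SPODG.MemC1per l (φ i))
    (hortho : Orthonormal ℝ (fun i => SPODG.toH l (φ i)))
    (hlin : LinearIndependent ℝ
      (Sum.elim (fun i => SPODG.toH l (φ i)) (fun i => SPODG.toH l (SPODG.dx l (φ i)))))
    (b : Fin m → SPODG.H l) (hb : ∀ k, SPODG.MemH1per l (b k)) (hb0 : ∀ k, b k ≠ 0)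
    (α₀ : EuclideanSpace ℝ (Fin n)) (hα₀ : α₀ ≠ 0) (z₀ : ℝ) :
    ∃ C : ℝ, 0 < C ∧
      ∀ u : SPODG.L2 0 T (SPODG.U m),
        ‖u‖ ^ 2 < ‖α₀‖ ^ 2 / (‖SPODG.controlOp b‖ ^ 2 * Real.exp 1 * T * (n : ℝ)) →
        ∃ (α : ℝ → EuclideanSpace ℝ (Fin n)) (z : ℝ → ℝ),
          SPODG.IsCaratheodorySolution l φ b T v α₀ z₀ u α z ∧
          (∀ (β : ℝ → EuclideanSpace ℝ (Fin n)) (w : ℝ → ℝ),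
            SPODG.IsCaratheodorySolution l φ b T v α₀ z₀ u β w →
              Set.EqOn β α (Set.Icc 0 T) ∧ Set.EqOn w z (Set.Icc 0 T)) ∧
          SPODG.MemH1 0 T α ∧ SPODG.MemH1 0 T z ∧
          max (SPODG.h1Norm 0 T α) (SPODG.h1Norm 0 T z) ≤ C := by
  choose b' hb' using fun k => (hb k).exists_inner_shift_dx hl
  obtain ⟨κ, hκ, hA⟩ := exists_norm_le_opA hlin
  have hα₀pos : 0 < ‖α₀‖ := norm_pos_iff.mpr hα₀
  have hn : 0 < n := by
    rcases Nat.eq_zero_or_pos n with rfl | h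
    · exact absurd (Subsingleton.elim α₀ 0) hα₀
    · exact h
  have hr : 0 < ‖α₀‖ / 3 := by positivity
  have hβ₁ := bddLip_shiftTest hl hφ hortho (controlOp b)
  have hβ₂ := bddLip_shiftTest hl hφ hortho (controlOp b')
  obtain ⟨M, hM⟩ := (bddLip_truncField (N := opN l φ) (div_pos hr hκ) hA hβ₁ hβ₂).1
  set R : ℝ := ‖α₀‖ ^ 2 / (‖controlOp b‖ ^ 2 * Real.exp 1 * T * (n : ℝ)) with hR
  -- Q bounds both α and z in the sup norm: the last bracket bounds ∫(|v| + M‖u‖), since ∫‖u‖ ≤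
  -- √(TR). Neither M nor R depends on u.
  set Q : ℝ := ‖α₀‖ + |z₀| + (|v| * T + M * Real.sqrt (T * R)) with hQ
  -- The summand 1 only makes the constant visibly positive.
  refine ⟨Real.sqrt (Q ^ 2 * T + (2 * v ^ 2 * T + 2 * M ^ 2 * R)) + 1, by positivity,
    fun u hu => ?_⟩
  have huL : MemLp u 2 (intervalMeasure 0 T) := Lp.memLp u
  have hui := intervalIntegrable_of_memLp hT.le huL
  have hI := sq_integral_norm_le hT huL
  rw [← norm_sq_eq_integral] at hI
  have hI' : ∫ t in 0..T, ‖u t‖ = ∫ t in Ioo 0 T, ‖u t‖ := intervalIntegral_eq_integral_Ioo hT.le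
  have hsmall := mul_le_two_thirds_of_sq_lt hn (norm_nonneg (controlOp b)) hT hα₀pos.le hI hu
  obtain ⟨α, z, hsol, huniq, hαb, hzb, g, hgi, hd, hgu⟩ := exists_reduced_solution (v := v)
    (α₀ := α₀) (z₀ := z₀) hT.le (norm_nonneg (controlOp b)) hr (inner_opN_self hl hφ) hκ hA
    hβ₁ hβ₂ (abs_inner_shiftTest_le hortho (controlOp b)) hui (by
      rw [intervalIntegral.integral_const_mul, hI']
      linarith) hM
  have hbound : ∫ t in 0..T, (|v| + M * ‖u t‖) ≤ |v| * T + M * Real.sqrt (T * R) := by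
    rw [intervalIntegral.integral_add intervalIntegrable_const (hui.norm.const_mul _),
      intervalIntegral.integral_const_mul, hI', intervalIntegral.integral_const, sub_zero,
      smul_eq_mul, mul_comm T]
    refine add_le_add le_rfl (mul_le_mul_of_nonneg_left (Real.le_sqrt_of_sq_le ?_) M.2)
    exact hI.trans (mul_le_mul_of_nonneg_left hu.le hT.le)
  have hR' : ∫ t in Ioo 0 T, ‖u t‖ ^ 2 ≤ R := by
    rw [← norm_sq_eq_integral]
    exact hu.le
  have hgm : AEStronglyMeasurable g (intervalMeasure 0 T) :=
    ((intervalIntegrable_iff_integrableOn_Ioo_of_le hT.le).mp hgi).aestronglyMeasurable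
  obtain ⟨h1, h2⟩ := memH1_and_h1Norm_le (A := Q) hT.le hsol.1 hgm.fst (hd.mono fun t ht => ht.1)
    (fun t ht => (hαb t ht).trans (by linarith [abs_nonneg z₀])) huL hR'
    (fun t => (norm_fst_le _).trans (hgu t))
  obtain ⟨h3, h4⟩ := memH1_and_h1Norm_le (A := Q) hT.le hsol.2.1 hgm.snd
    (hd.mono fun t ht => ht.2) (fun t ht => (hzb t ht).trans (by linarith)) huL hR'
    (fun t => (norm_snd_le _).trans (hgu t))
  have hiff := fun β w => isCaratheodorySolution_iff (T := T) (v := v) (α₀ := α₀) (z₀ := z₀)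
    (u := u) (α := β) (z := w) hl hφ hortho hb'
  exact ⟨α, z, (hiff α z).mpr hsol, fun β w h => huniq β w ((hiff β w).mp h), h1, h3,
    max_le (h2.trans (by linarith)) (h4.trans (by linarith))⟩
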